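/- Let $(\Omega,\mathcal F,P)$ be a probability space with a filtration $\mathcal F_0\subset\mathcal F_1\subset\mathcal F_2\subset\cdots\subset\mathcal F$ such that $\sigma(\bigcup_k\mathcal F_k)=\mathcal F$ and every $\mathcal F_k$ is generated by countably many atoms (a countable partition of $\Omega$). Assume that the filtration is regular: there is $C>0$ such that for all $k\ge1$ and $F\in\mathcal F_k$ there is $G\in\mathcal F_{k-1}$ with $F\subset G$ and $P(G)\le C\,P(F)$. (Typical choices of $\mathcal F_0$ are $\{\emptyset,\Omega\}$, or $\mathcal F_0=\mathcal F_1$; in the latter case regularity is a condition for $k\ge2$ only.) Functions are real or complex valued. For $f\in L^1(\Omega)$ put $f_k=\mathbb E(f\mid\mathcal F_k)$ for $k\ge1$, $f_0=0$, and $S(f)=\big(\sum_{k\ge1}|f_k-f_{k-1}|^2\big)^{1/2}$. Let $H^1(\Omega)=\{f\in L^1(\Omega):\|f\|_{H^1}=\|S(f)\|_1<\infty\}$. For $0<p<1$ let $H^p(\Omega)$ be the completion of $\{f\in L^1(\Omega):\|S(f)\|_p<\infty\}$ with respect to the quasi-norm $\|f\|_{H^p}=\|S(f)\|_p$. With $\alpha_p=\frac1p-1$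 let $$\Lambda_1(\alpha_p)=\Big\{g\in L^2(\Omega):\ \|g\|_{\Lambda_1(\alpha_p)}=\sup_{n\ge0}\ \sup_{A\in\mathcal F_n,\,P(A)>0}P(A)^{-1-\alpha_p}\int_A|g-g_n|\,dP<\infty\Big\}.$$ Let $0<p<1$. There is a (necessarily unique) continuous bilinear form $(f,g)\mapsto\langle g,f\rangle$ on $H^p(\Omega)\times\Lambda_1(\alpha_p)$ such that $fg$ is integrable and $\langle g,f\rangle=\mathbb E(fg)$ whenever $f\in L^1(\Omega)$, $\|S(f)\|_p<\infty$. For $g\in\Lambda_1(\alpha_p)$ and $h\in L^\infty(\Omega)\cap\Lambda_1(\alpha_p)$ one has $hg\in\Lambda_1(\alpha_p)$, so that for $f\in H^p(\Omega)$ the product $f\times g$ is defined as the functional $\langle f\times g,h\rangle=\langle hg,f\rangle$ on $L^\infty(\Omega)\cap\Lambda_1(\alpha_p)$. Moreover there exist continuous bilinear operators $\Pi_1:H^p(\Omega)\times\Lambda_1(\alpha_p)\to L^1(\Omega)$, $\Pi_2:H^p(\Omega)\times\Lambda_1(\alpha_p)\to H^1(\Omega)$ and $\Pi_3:H^p(\Omega)\times\Lambda_1(\alpha_p)\to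 H^p(\Omega)$ such that $$f\times g=\Pi_1(f,g)+\Pi_2(f,g)+\Pi_3(f,g)\qquad\text{for all } f\in H^p(\Omega),\ g\in\Lambda_1(\alpha_p),$$ that is, for all $h\in L^\infty(\Omega)\cap\Lambda_1(\alpha_p)$, $$\langle hg,f\rangle=\mathbb E\big(\Pi_1(f,g)\,h\big)+\mathbb E\big(\Pi_2(f,g)\,h\big)+\langle h,\Pi_3(f,g)\rangle .$$ -/

import Mathlib

open MeasureTheory
open scoped ENNReal

namespace MartHardy

noncomputable section

/-! ### Filtrations -/

/-- A filtration `𝓕 0 ⊆ 𝓕 1 ⊆ ⋯` is regular if there is a constant `C` such that every `F ∈ 𝓕 k`,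
`k ≥ 1`, is contained in some `G ∈ 𝓕 (k - 1)` with `P G ≤ C * P F`. -/
def IsRegular {Ω : Type*} {m0 : MeasurableSpace Ω} (P : Measure Ω) (𝓕 : Filtration ℕ m0) : Prop :=
  ∃ C : ℝ, 0 < C ∧ ∀ k : ℕ, ∀ F : Set Ω, MeasurableSet[𝓕 (k + 1)] F →
    ∃ G : Set Ω, MeasurableSet[𝓕 k] G ∧ F ⊆ G ∧ P G ≤ ENNReal.ofReal C * P F

/-- A σ-algebra generated by countably many atoms, i.e. by a countable partition of the space. -/
def CountablyAtomic {Ω : Type*} (m : MeasurableSpace Ω) : Prop :=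
  ∃ 𝒜 : Set (Set Ω), 𝒜.Countable ∧ 𝒜.PairwiseDisjoint id ∧ ⋃₀ 𝒜 = Set.univ ∧
    m = MeasurableSpace.generateFrom 𝒜

/-! ### Martingales and square functions -/

section Defs

variable {Ω : Type*} {m0 : MeasurableSpace Ω} {𝕜 : Type*} [RCLike 𝕜]

/-- The martingale `f_k = E(f | 𝓕 k)`, `k ≥ 1`, of `f`, with the convention `f_0 = 0`. -/
def mart (P : Measure Ω) (𝓕 : Filtration ℕ m0) (f : Ω → 𝕜) : ℕ → Ω → 𝕜
  | 0 => 0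
  | k + 1 => P[f | 𝓕 (k + 1)]

/-- The square function `S(f) = (∑_{k ≥ 1} |f_k - f_{k-1}|²)^{1/2}`, with values in `[0, ∞]`. -/
def squareFn (P : Measure Ω) (𝓕 : Filtration ℕ m0) (f : Ω → 𝕜) (ω : Ω) : ℝ≥0∞ :=
  (∑' k : ℕ, ‖mart P 𝓕 f (k + 1) ω - mart P 𝓕 f k ω‖ₑ ^ (2 : ℝ)) ^ (1 / 2 : ℝ)

/-- `‖S(f)‖_p ^ p = E (S(f) ^ p)`. -/
def squareMoment (P : Measure Ω) (𝓕 : Filtration ℕ m0) (p : ℝ) (f : Ω → 𝕜) : ℝ≥0∞ :=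
  ∫⁻ ω, squareFn P 𝓕 f ω ^ p ∂P

/-- The norm of the martingale Lipschitz space `Λ_1(α)`:
the supremum over `n ≥ 0` and `A ∈ 𝓕 n` of `P(A) ^ (-1 - α) * ∫_A |g - g_n| dP`.
The term `n = 0` has `g_0 = 0`. (Null sets `A` contribute `0`.) -/
def lipENorm (P : Measure Ω) (𝓕 : Filtration ℕ m0) (α : ℝ) (g : Ω → 𝕜) : ℝ≥0∞ :=
  ⨆ (n : ℕ) (A : Set Ω) (_ : MeasurableSet[𝓕 n] A),
    P A ^ (-1 - α) * ∫⁻ ω in A, ‖g ω - mart P 𝓕 g n ω‖ₑ ∂P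

/-! #### Elementary properties needed for the definitions of the spaces -/

variable {P : Measure Ω} {𝓕 : Filtration ℕ m0} {f g : Ω → 𝕜}

lemma mart_congr (h : f =ᵐ[P] g) (n : ℕ) : mart P 𝓕 f n =ᵐ[P] mart P 𝓕 g n := by
  cases n with
  | zero => rfl
  | succ k => exact condExp_congr_ae h

lemma mart_add (hf : Integrable f P) (hg : Integrable g P) (n : ℕ) :
    mart P 𝓕 (f + g) n =ᵐ[P] mart P 𝓕 f n + mart P 𝓕 g n := by
  cases n with
  | zero => simp [mart]
  | succ k => exact condExp_add hf hg _

lemma mart_smul (c : 𝕜) (n : ℕ) : mart P 𝓕 (c • f) n =ᵐ[P] c • mart P 𝓕 f n := by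
  cases n with
  | zero => simp [mart]
  | succ k => exact condExp_smul c f _

lemma measurable_mart (f : Ω → 𝕜) (n : ℕ) : Measurable (mart P 𝓕 f n) := by
  cases n with
  | zero => exact measurable_const
  | succ k => exact (stronglyMeasurable_condExp.mono (𝓕.le _)).measurable

lemma measurable_squareFn (f : Ω → 𝕜) : Measurable (squareFn P 𝓕 f) := by
  refine Measurable.pow_const (Measurable.tsum fun k => ?_) _
  exact (((measurable_mart f (k + 1)).sub (measurable_mart f k)).enorm).pow_const _

lemma squareFn_congr (h : f =ᵐ[P] g) : squareFn P 𝓕 f =ᵐ[P] squareFn P 𝓕 g := by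
  filter_upwards [ae_all_iff.2 fun n => mart_congr (𝓕 := 𝓕) h n] with ω hω
  simp only [squareFn, hω]

lemma tsum_minkowski (a b : ℕ → ℝ≥0∞) :
    (∑' k, (a k + b k) ^ (2 : ℝ)) ^ (1 / 2 : ℝ) ≤
      (∑' k, a k ^ (2 : ℝ)) ^ (1 / 2 : ℝ) + (∑' k, b k ^ (2 : ℝ)) ^ (1 / 2 : ℝ) := by
  have key : ∑' k, (a k + b k) ^ (2 : ℝ) ≤
      ((∑' k, a k ^ (2 : ℝ)) ^ (1 / 2 : ℝ) + (∑' k, b k ^ (2 : ℝ)) ^ (1 / 2 : ℝ)) ^ (2 : ℝ) := by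
    rw [ENNReal.tsum_eq_iSup_sum]
    refine iSup_le fun s => ?_
    have h1 := ENNReal.Lp_add_le s a b (p := 2) (by norm_num)
    have h2 := ENNReal.rpow_le_rpow h1 (z := 2) (by norm_num)
    rw [← ENNReal.rpow_mul, show (1 / 2 : ℝ) * 2 = 1 by norm_num, ENNReal.rpow_one] at h2
    refine h2.trans (ENNReal.rpow_le_rpow (add_le_add ?_ ?_) (by norm_num)) <;>
    exact ENNReal.rpow_le_rpow (ENNReal.sum_le_tsum s) (by norm_num)
  have := ENNReal.rpow_le_rpow key (z := 1 / 2) (by norm_num)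
  rwa [← ENNReal.rpow_mul, show (2 : ℝ) * (1 / 2) = 1 by norm_num, ENNReal.rpow_one] at this

lemma squareFn_add_le (hf : Integrable f P) (hg : Integrable g P) :
    ∀ᵐ ω ∂P, squareFn P 𝓕 (f + g) ω ≤ squareFn P 𝓕 f ω + squareFn P 𝓕 g ω := by
  filter_upwards [ae_all_iff.2 fun n => mart_add (𝓕 := 𝓕) hf hg n] with ω hω
  refine le_trans ?_ (tsum_minkowski _ _)
  unfold squareFn
  gcongr with k
  rw [hω, hω, Pi.add_apply, Pi.add_apply, add_sub_add_comm]
  exact enorm_add_le _ _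

lemma squareFn_smul (c : 𝕜) :
    squareFn P 𝓕 (c • f) =ᵐ[P] fun ω => ‖c‖ₑ * squareFn P 𝓕 f ω := by
  filter_upwards [ae_all_iff.2 fun n => mart_smul (P := P) (𝓕 := 𝓕) (f := f) c n] with ω hω
  have h : ∀ k, ‖mart P 𝓕 (c • f) (k + 1) ω - mart P 𝓕 (c • f) k ω‖ₑ ^ (2 : ℝ)
      = ‖c‖ₑ ^ (2 : ℝ) * ‖mart P 𝓕 f (k + 1) ω - mart P 𝓕 f k ω‖ₑ ^ (2 : ℝ) := fun k => by
    rw [hω, hω, Pi.smul_apply, Pi.smul_apply, ← smul_sub, enorm_smul,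
      ENNReal.mul_rpow_of_nonneg _ _ (by norm_num)]
  simp only [squareFn, h]
  rw [ENNReal.tsum_mul_left, ENNReal.mul_rpow_of_nonneg _ _ (by norm_num), ← ENNReal.rpow_mul,
    show (2 : ℝ) * (1 / 2) = 1 by norm_num, ENNReal.rpow_one]

lemma squareMoment_congr (p : ℝ) (h : f =ᵐ[P] g) :
    squareMoment P 𝓕 p f = squareMoment P 𝓕 p g := by
  refine lintegral_congr_ae ?_
  filter_upwards [squareFn_congr (𝓕 := 𝓕) h] with ω hω
  rw [hω]

lemma squareMoment_add_le {p : ℝ} (hp : p ∈ Set.Ioc (0 : ℝ) 1) (hf : Integrable f P)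
    (hg : Integrable g P) :
    squareMoment P 𝓕 p (f + g) ≤ squareMoment P 𝓕 p f + squareMoment P 𝓕 p g := by
  unfold squareMoment
  rw [← lintegral_add_left ((measurable_squareFn f).pow_const p)]
  refine lintegral_mono_ae ?_
  filter_upwards [squareFn_add_le (𝓕 := 𝓕) hf hg] with ω hω
  exact (ENNReal.rpow_le_rpow hω hp.1.le).trans (ENNReal.rpow_add_le_add_rpow _ _ hp.1.le hp.2)

lemma squareMoment_smul {p : ℝ} (hp : p ∈ Set.Ioc (0 : ℝ) 1) (c : 𝕜) :
    squareMoment P 𝓕 p (c • f) = ‖c‖ₑ ^ p * squareMoment P 𝓕 p f := by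
  unfold squareMoment
  rw [← lintegral_const_mul _ ((measurable_squareFn f).pow_const p)]
  refine lintegral_congr_ae ?_
  filter_upwards [squareFn_smul (P := P) (𝓕 := 𝓕) (f := f) c] with ω hω
  rw [hω, ENNReal.mul_rpow_of_nonneg _ _ hp.1.le]

lemma squareMoment_zero {p : ℝ} (hp : p ∈ Set.Ioc (0 : ℝ) 1) :
    squareMoment P 𝓕 p (0 : Ω → 𝕜) = 0 := by
  have := squareMoment_smul (P := P) (𝓕 := 𝓕) (f := (0 : Ω → 𝕜)) hp (0 : 𝕜)
  rwa [zero_smul, enorm_zero, ENNReal.zero_rpow_of_pos hp.1, zero_mul] at this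

lemma lipENorm_congr (α : ℝ) (h : f =ᵐ[P] g) : lipENorm P 𝓕 α f = lipENorm P 𝓕 α g := by
  unfold lipENorm
  refine iSup_congr fun n => iSup_congr fun A => iSup_congr fun _ => ?_
  congr 1
  refine lintegral_congr_ae (ae_restrict_of_ae ?_)
  filter_upwards [h, mart_congr (𝓕 := 𝓕) h n] with ω h1 h2
  rw [h1, h2]

lemma lipENorm_add_le (α : ℝ) (hf : Integrable f P) (hg : Integrable g P) :
    lipENorm P 𝓕 α (f + g) ≤ lipENorm P 𝓕 α f + lipENorm P 𝓕 α g := by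
  refine iSup_le fun n => iSup_le fun A => iSup_le fun hA => ?_
  have hle : ∀ u : Ω → 𝕜, P A ^ (-1 - α) * ∫⁻ ω in A, ‖u ω - mart P 𝓕 u n ω‖ₑ ∂P
      ≤ lipENorm P 𝓕 α u := fun u =>
    le_iSup_of_le n (le_iSup_of_le A (le_iSup_of_le hA le_rfl))
  refine le_trans ?_ (add_le_add (hle f) (hle g))
  rw [← mul_add]
  gcongr
  rw [← lintegral_add_left']
  · refine lintegral_mono_ae (ae_restrict_of_ae ?_)
    filter_upwards [mart_add (𝓕 := 𝓕) hf hg n] with ω hω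
    rw [hω, Pi.add_apply, Pi.add_apply, add_sub_add_comm]
    exact enorm_add_le _ _
  · exact (hf.1.aemeasurable.sub (measurable_mart f n).aemeasurable).enorm.restrict

lemma lipENorm_smul (α : ℝ) (c : 𝕜) :
    lipENorm P 𝓕 α (c • f) = ‖c‖ₑ * lipENorm P 𝓕 α f := by
  unfold lipENorm
  simp only [ENNReal.mul_iSup]
  refine iSup_congr fun n => iSup_congr fun A => iSup_congr fun hA => ?_
  rw [mul_left_comm, ← lintegral_const_mul' _ _ enorm_ne_top]
  congr 1
  refine lintegral_congr_ae (ae_restrict_of_ae ?_)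
  filter_upwards [mart_smul (P := P) (𝓕 := 𝓕) (f := f) c n] with ω hω
  rw [hω, Pi.smul_apply, Pi.smul_apply, ← smul_sub, enorm_smul]

end Defs

/-! ### The Hardy spaces -/

section Hardy

variable {Ω : Type*} {m0 : MeasurableSpace Ω} (𝕜 : Type*) [RCLike 𝕜]
  (P : Measure Ω) (𝓕 : Filtration ℕ m0)

/-- The linear space `{f ∈ L¹ : ‖S(f)‖_p < ∞}`, `0 < p ≤ 1`. -/
def hardySubmodule (p : Set.Ioc (0 : ℝ) 1) : Submodule 𝕜 (Lp 𝕜 1 P) where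
  carrier := {f | squareMoment P 𝓕 p f < ∞}
  zero_mem' := by
    have h : squareMoment P 𝓕 p ((0 : Lp 𝕜 1 P) : Ω → 𝕜) = 0 :=
      (squareMoment_congr _ (Lp.coeFn_zero _ _ _)).trans (squareMoment_zero p.2)
    exact h.trans_lt ENNReal.zero_lt_top
  add_mem' {f g} hf hg := by
    have h := squareMoment_add_le (𝓕 := 𝓕) p.2 (L1.integrable_coeFn f) (L1.integrable_coeFn g)
    rw [← squareMoment_congr _ (Lp.coeFn_add f g)] at h
    exact h.trans_lt (ENNReal.add_lt_top.2 ⟨hf, hg⟩)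
  smul_mem' c f hf := by
    change squareMoment P 𝓕 p _ < ∞
    rw [squareMoment_congr _ (Lp.coeFn_smul c f), squareMoment_smul p.2]
    exact ENNReal.mul_lt_top (ENNReal.rpow_lt_top_of_nonneg p.2.1.le enorm_ne_top) hf

/-- The space `{f ∈ L¹ : ‖S(f)‖_p < ∞}`, `0 < p ≤ 1`, with the translation invariant
(pseudo)metric `d(f, g) = ‖S(f - g)‖_p ^ p`, which induces the topology and the uniform
structure of the quasi-norm `‖S(f)‖_p`. (The definition is a type synonym, so
that the norm of `L¹` is not inherited.) For `p = 1` this is the Hardy space `H¹`. -/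
def HardyL1 (p : Set.Ioc (0 : ℝ) 1) : Type _ := hardySubmodule 𝕜 P 𝓕 p

variable (p : Set.Ioc (0 : ℝ) 1)

instance : AddCommGroup (HardyL1 𝕜 P 𝓕 p) :=
  inferInstanceAs (AddCommGroup (hardySubmodule 𝕜 P 𝓕 p))

instance : Module 𝕜 (HardyL1 𝕜 P 𝓕 p) :=
  inferInstanceAs (Module 𝕜 (hardySubmodule 𝕜 P 𝓕 p))

variable {𝕜 P 𝓕 p}

/-- The inclusion of `{f ∈ L¹ : ‖S(f)‖_p < ∞}` into `L¹`. -/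
def HardyL1.toL1 : HardyL1 𝕜 P 𝓕 p →ₗ[𝕜] Lp 𝕜 1 P := (hardySubmodule 𝕜 P 𝓕 p).subtype

/-- `‖S(f)‖_p ^ p`. -/
def HardyL1.moment (f : HardyL1 𝕜 P 𝓕 p) : ℝ≥0∞ := squareMoment P 𝓕 p f.toL1

lemma HardyL1.moment_ne_top (f : HardyL1 𝕜 P 𝓕 p) : f.moment ≠ ∞ := (Subtype.prop f).ne

lemma HardyL1.moment_zero : (0 : HardyL1 𝕜 P 𝓕 p).moment = 0 := by
  unfold moment
  rw [map_zero]
  exact (squareMoment_congr _ (Lp.coeFn_zero _ _ _)).trans (squareMoment_zero p.2)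

lemma HardyL1.moment_add_le (f g : HardyL1 𝕜 P 𝓕 p) :
    (f + g).moment ≤ f.moment + g.moment := by
  unfold moment
  rw [map_add, squareMoment_congr _ (Lp.coeFn_add _ _)]
  exact squareMoment_add_le p.2 (L1.integrable_coeFn _) (L1.integrable_coeFn _)

lemma HardyL1.moment_smul (c : 𝕜) (f : HardyL1 𝕜 P 𝓕 p) :
    (c • f).moment = ‖c‖ₑ ^ (p : ℝ) * f.moment := by
  unfold moment
  rw [map_smul, squareMoment_congr _ (Lp.coeFn_smul _ _)]
  exact squareMoment_smul p.2 c

lemma HardyL1.moment_neg (f : HardyL1 𝕜 P 𝓕 p) : (-f).moment = f.moment := by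
  rw [← neg_one_smul 𝕜 f, moment_smul]
  simp

/-- The metric `d(f, g) = ‖S(f - g)‖_p ^ p`. -/
instance : PseudoMetricSpace (HardyL1 𝕜 P 𝓕 p) :=
  @PseudoEMetricSpace.toPseudoMetricSpace _
    { edist := fun f g => (f - g).moment
      edist_self := fun f => by rw [sub_self, HardyL1.moment_zero]
      edist_comm := fun f g => by rw [← HardyL1.moment_neg, neg_sub]
      edist_triangle := fun f g h => by
        rw [← sub_add_sub_cancel f g h]
        exact HardyL1.moment_add_le _ _ }
    fun f g => (f - g).moment_ne_top

lemma HardyL1.edist_def (f g : HardyL1 𝕜 P 𝓕 p) : edist f g = (f - g).moment := rfl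

instance : IsUniformAddGroup (HardyL1 𝕜 P 𝓕 p) where
  uniformContinuous_sub := by
    refine LipschitzWith.uniformContinuous (K := 2) fun x y => ?_
    rw [HardyL1.edist_def, sub_sub_sub_comm, sub_eq_add_neg]
    refine (HardyL1.moment_add_le _ _).trans ?_
    rw [HardyL1.moment_neg, ← HardyL1.edist_def, ← HardyL1.edist_def, ENNReal.coe_ofNat, two_mul]
    exact add_le_add (le_max_left _ _) (le_max_right _ _)

instance : UniformContinuousConstSMul 𝕜 (HardyL1 𝕜 P 𝓕 p) where
  uniformContinuous_const_smul c := by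
    refine LipschitzWith.uniformContinuous (K := ‖c‖₊ ^ (p : ℝ)) fun x y => ?_
    rw [HardyL1.edist_def, HardyL1.edist_def, ← smul_sub, HardyL1.moment_smul,
      ENNReal.coe_rpow_of_nonneg _ p.2.1.le]
    rfl

variable (𝕜 P 𝓕)

/-- The martingale Hardy space `H^p`, `0 < p < 1`: the completion of `{f ∈ L¹ : ‖S(f)‖_p < ∞}`
with respect to the quasi-norm `‖S(f)‖_p`. -/
abbrev Hardy (p : ℝ) (hp0 : 0 < p) (hp1 : p < 1) : Type _ :=
  UniformSpace.Completion (HardyL1 𝕜 P 𝓕 ⟨p, hp0, hp1.le⟩)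

/-- The martingale Hardy space `H¹ = {f ∈ L¹ : ‖S(f)‖_1 < ∞}` with the norm `‖S(f)‖_1`. -/
abbrev HardyOne : Type _ := HardyL1 𝕜 P 𝓕 ⟨1, one_pos, le_rfl⟩

end Hardy

/-! ### The martingale Lipschitz spaces -/

section Lip

variable {Ω : Type*} {m0 : MeasurableSpace Ω} (𝕜 : Type*) [RCLike 𝕜]
  (P : Measure Ω) [IsProbabilityMeasure P] (𝓕 : Filtration ℕ m0)

lemma integrable_L2 {Ω : Type*} {m0 : MeasurableSpace Ω} {𝕜 : Type*} [RCLike 𝕜]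
    {P : Measure Ω} [IsProbabilityMeasure P] (g : Lp 𝕜 2 P) : Integrable g P :=
  (Lp.memLp g).integrable (by norm_num)

/-- The linear space `{g ∈ L² : ‖g‖_{Λ_1(α)} < ∞}`. -/
def lipSubmodule (α : ℝ) : Submodule 𝕜 (Lp 𝕜 2 P) where
  carrier := {g | lipENorm P 𝓕 α g < ∞}
  zero_mem' := by
    have h : lipENorm P 𝓕 α ((0 : Lp 𝕜 2 P) : Ω → 𝕜) = 0 := by
      rw [lipENorm_congr _ (Lp.coeFn_zero _ _ _), ← zero_smul 𝕜 (0 : Ω → 𝕜), lipENorm_smul]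
      simp
    exact h.trans_lt ENNReal.zero_lt_top
  add_mem' {f g} hf hg := by
    have h := lipENorm_add_le (𝓕 := 𝓕) α (integrable_L2 f) (integrable_L2 g)
    rw [← lipENorm_congr _ (Lp.coeFn_add f g)] at h
    exact h.trans_lt (ENNReal.add_lt_top.2 ⟨hf, hg⟩)
  smul_mem' c f hf := by
    change lipENorm P 𝓕 α _ < ∞
    rw [lipENorm_congr _ (Lp.coeFn_smul c f), lipENorm_smul]
    exact ENNReal.mul_lt_top enorm_lt_top hf

/-- The martingale Lipschitz space `Λ_1(α)`, with its own norm (a type synonym, so that the norm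
of `L²` is not inherited). -/
def Lip (α : ℝ) : Type _ := lipSubmodule 𝕜 P 𝓕 α

variable (α : ℝ)

instance : AddCommGroup (Lip 𝕜 P 𝓕 α) := inferInstanceAs (AddCommGroup (lipSubmodule 𝕜 P 𝓕 α))

instance : Module 𝕜 (Lip 𝕜 P 𝓕 α) := inferInstanceAs (Module 𝕜 (lipSubmodule 𝕜 P 𝓕 α))

variable {𝕜 P 𝓕 α}

/-- The inclusion of `Λ_1(α)` into `L²`. -/
def Lip.toL2 : Lip 𝕜 P 𝓕 α →ₗ[𝕜] Lp 𝕜 2 P := (lipSubmodule 𝕜 P 𝓕 α).subtype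

instance : Norm (Lip 𝕜 P 𝓕 α) := ⟨fun g => (lipENorm P 𝓕 α g.toL2).toReal⟩

lemma Lip.core : SeminormedSpace.Core 𝕜 (Lip 𝕜 P 𝓕 α) where
  norm_nonneg _ := ENNReal.toReal_nonneg
  norm_smul c g := by
    change (lipENorm P 𝓕 α _).toReal = _ * (lipENorm P 𝓕 α _).toReal
    rw [map_smul, lipENorm_congr _ (Lp.coeFn_smul _ _), lipENorm_smul, ENNReal.toReal_mul,
      toReal_enorm]
  norm_triangle f g := by
    change (lipENorm P 𝓕 α _).toReal ≤ (lipENorm P 𝓕 α _).toReal + (lipENorm P 𝓕 α _).toReal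
    have hf : lipENorm P 𝓕 α f.toL2 ≠ ∞ := (Subtype.prop f).ne
    have hg : lipENorm P 𝓕 α g.toL2 ≠ ∞ := (Subtype.prop g).ne
    rw [← ENNReal.toReal_add hf hg, map_add, lipENorm_congr _ (Lp.coeFn_add _ _)]
    exact ENNReal.toReal_mono (ENNReal.add_ne_top.2 ⟨hf, hg⟩)
      (lipENorm_add_le α (integrable_L2 _) (integrable_L2 _))

instance : SeminormedAddCommGroup (Lip 𝕜 P 𝓕 α) := .ofCore Lip.core

end Lip

/-! ### The duality pairing and the distributional product -/

section Duality

variable {Ω : Type*} {m0 : MeasurableSpace Ω} {𝕜 : Type*} [RCLike 𝕜]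
  {P : Measure Ω} [IsProbabilityMeasure P] {𝓕 : Filtration ℕ m0}
  {p : ℝ} {hp0 : 0 < p} {hp1 : p < 1} {α : ℝ}

/-- `B(f, g) = ⟨g, f⟩` is the duality pairing between `H^p` and `Λ_1(α)`: the continuous bilinear
form which is `E(f g)` for `f` in the dense subspace `{f ∈ L¹ : ‖S(f)‖_p < ∞}` of `H^p`.
By density there is at most one such form. -/
def IsDualityPairing (B : Hardy 𝕜 P 𝓕 p hp0 hp1 →ₗ[𝕜] Lip 𝕜 P 𝓕 α →ₗ[𝕜] 𝕜) : Prop :=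
  (Continuous fun x : Hardy 𝕜 P 𝓕 p hp0 hp1 × Lip 𝕜 P 𝓕 α => B x.1 x.2) ∧
    ∀ (f : HardyL1 𝕜 P 𝓕 ⟨p, hp0, hp1.le⟩) (g : Lip 𝕜 P 𝓕 α),
      Integrable (fun ω => f.toL1 ω * g.toL2 ω) P ∧
        B (f : Hardy 𝕜 P 𝓕 p hp0 hp1) g = ∫ ω, f.toL1 ω * g.toL2 ω ∂P

end Duality

end

end MartHardy

/-!
The product `f g` of a Hardy function and a Lipschitz function is split by summation by parts:
with `f_k = E(f | 𝓕 k)` and `Δ_k f = f_{k+1} - f_k`,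

  `f_n g_n = ∑_{k < n} (Δ_k f Δ_k g + f_k Δ_k g + g_k Δ_k f)`,

and the three sums give `Π₁`, `Π₂` and `Π₃`. Everything rests on the weight `w_k(ω)`, the measure of
the atom of `𝓕 k` containing `ω`. By regularity an atom either keeps its measure in the next
generation, and then all martingale differences vanish there, or it loses a fixed proportion of its
measure; so along the relevant steps the weights decrease geometrically
(`weight_le_or_mdiff_eq_zero`).

* For `g ∈ Λ_1(α)` one has `|Δ_k g| ≤ c ‖g‖ w_{k+1} ^ α` (`norm_mdiff_le`), and hence
  `∑_{k ≥ j} |Δ_k g| ≤ c ‖g‖ w_j ^ α` (`tsum_enorm_mdiff_le`). In particular `g` is bounded, and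
  `Λ_1(α)` is closed under products (`Lip.exists_mul`).
* For `f ∈ H^p` and `α = 1/p - 1` the bounds `|Δ_k f| ≤ S(f)` and
  `|Δ_k f| ^ p w_{k+1} ≤ ‖S(f)‖_p ^ p` give
  `∑ |Δ_k f| w_{k+1} ^ α ≤ c S(f) ^ p ‖S(f)‖_p ^ (1-p)`, as the sum is dominated by the terms with
  `w_{k+1}` near the value at which the two bounds agree (`sum_mul_weight_le`,
  `weightedSum_le`). The right side has integral `c ‖S(f)‖_p`.

Therefore `∑ |Δ_k f Δ_k g|` is integrable, and so is `∑ |f_k Δ_k g|`, since `|f_k|` is at most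
`∑_{j < k} |Δ_j f|` and the sum over `k > j` can be carried out first. No atomic decomposition and
no maximal inequality is needed. As `f_k Δ_k g` are martingale differences, the square function of
`Π₂` is at most `∑ |f_k Δ_k g|`. For integrable `f` the remainder `f g - Π₁ - Π₂` has the martingale
differences `g_k Δ_k f`, so that its square function is at most `‖g‖_∞ S(f)`
(`exists_decomposition`). As `Π₂` and `Π₃` have mean zero, `E(f g) = E(Π₁(f, g))`, so the duality
pairing is the composition of `Π₁` with the integral. These bilinear maps extend to the completion
by continuity (`exists_bilinear_extension`), and the identity for `f × g` follows by density.
-/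

namespace MartHardy

noncomputable section

/-! ### Atoms of a countably generated partition -/

section Atoms

variable {Ω : Type*}

/-- The atom of `m` containing `ω`: the intersection of all `m`-measurable sets containing `ω`. -/
def atomOf (m : MeasurableSpace Ω) (ω : Ω) : Set Ω := @measurableAtom Ω m ω

lemma mem_atomOf (m : MeasurableSpace Ω) (ω : Ω) : ω ∈ atomOf m ω :=
  @mem_measurableAtom_self Ω m ω

lemma atomOf_subset {m : MeasurableSpace Ω} {s : Set Ω} {ω : Ω} (hs : MeasurableSet[m] s)
    (hω : ω ∈ s) : atomOf m ω ⊆ s :=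
  @measurableAtom_subset Ω m s ω hs hω

lemma atomOf_eq_of_mem {m : MeasurableSpace Ω} {ω ω' : Ω} (h : ω' ∈ atomOf m ω) :
    atomOf m ω' = atomOf m ω :=
  @measurableAtom_eq_of_mem Ω m ω' ω h

lemma atomOf_anti {m m' : MeasurableSpace Ω} (h : m ≤ m') (ω : Ω) : atomOf m' ω ⊆ atomOf m ω := by
  intro x hx
  simp only [atomOf, measurableAtom, Set.mem_iInter] at hx ⊢
  exact fun s hωs hs => hx s hωs (h s hs)

lemma eq_of_mem_atomOf {m : MeasurableSpace Ω} {E : Type*} [MeasurableSpace E]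
    [MeasurableSingletonClass E] {u : Ω → E} (hu : Measurable[m] u) {ω ω' : Ω}
    (h : ω' ∈ atomOf m ω) : u ω' = u ω :=
  atomOf_subset (hu (measurableSet_singleton (u ω))) rfl h

/-- The atom of `ω` is the cell of the generating partition that contains `ω`. -/
lemma atomOf_eq_cell {𝒜 : Set (Set Ω)} (hdisj : 𝒜.PairwiseDisjoint id) {A : Set Ω} (hA : A ∈ 𝒜)
    {ω : Ω} (hω : ω ∈ A) : atomOf (MeasurableSpace.generateFrom 𝒜) ω = A := by
  refine Set.Subset.antisymm (atomOf_subset (MeasurableSpace.measurableSet_generateFrom hA) hω) ?_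
  -- every measurable set contains the cell `A` or is disjoint from it
  have key : ∀ s, MeasurableSet[MeasurableSpace.generateFrom 𝒜] s → A ⊆ s ∨ Disjoint A s := by
    intro s hs
    induction s, hs using MeasurableSpace.generateFrom_induction with
    | hC t ht _ =>
      by_cases h : A = t
      · exact Or.inl h.subset
      · exact Or.inr (hdisj hA ht h)
    | empty => exact Or.inr (Set.disjoint_empty A)
    | compl t _ h =>
      rcases h with h | h
      · exact Or.inr (Set.disjoint_compl_right_iff_subset.2 h)
      · exact Or.inl (Set.subset_compl_iff_disjoint_right.2 h)
    | iUnion t _ h =>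
      by_cases h' : ∃ i, A ⊆ t i
      · obtain ⟨i, hi⟩ := h'
        exact Or.inl (hi.trans (Set.subset_iUnion t i))
      · push Not at h'
        exact Or.inr (Set.disjoint_iUnion_right.2 fun i => (h i).resolve_left (h' i))
  intro x hx
  simp only [atomOf, measurableAtom, Set.mem_iInter]
  intro s hωs hs
  exact (key s hs).elim (fun h => h hx) fun h => (Set.disjoint_left.1 h hω hωs).elim

lemma CountablyAtomic.measurableSet_atomOf {m : MeasurableSpace Ω} (hm : CountablyAtomic m)
    (ω : Ω) : MeasurableSet[m] (atomOf m ω) := by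
  obtain ⟨𝒜, -, hdisj, hun, rfl⟩ := hm
  obtain ⟨A, hA, hω⟩ : ω ∈ ⋃₀ 𝒜 := hun ▸ Set.mem_univ ω
  rw [atomOf_eq_cell hdisj hA hω]
  exact MeasurableSpace.measurableSet_generateFrom hA

lemma CountablyAtomic.countable_range_atomOf {m : MeasurableSpace Ω} (hm : CountablyAtomic m) :
    (Set.range (atomOf m)).Countable := by
  obtain ⟨𝒜, hc, hdisj, hun, rfl⟩ := hm
  refine hc.mono ?_
  rintro _ ⟨ω, rfl⟩
  obtain ⟨A, hA, hω⟩ : ω ∈ ⋃₀ 𝒜 := hun ▸ Set.mem_univ ω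
  rwa [atomOf_eq_cell hdisj hA hω]

lemma CountablyAtomic.ae_measure_atomOf_ne_zero {m m0 : MeasurableSpace Ω}
    (hm : CountablyAtomic m) (P : Measure Ω) : ∀ᵐ ω ∂P, P (atomOf m ω) ≠ 0 := by
  have h : P (⋃ A ∈ {A ∈ Set.range (atomOf m) | P A = 0}, A) = 0 :=
    (measure_biUnion_null_iff (hm.countable_range_atomOf.mono (Set.sep_subset _ _))).2
      fun A hA => hA.2
  refine measure_mono_null (fun ω hω => ?_) h
  simp only [Set.mem_compl_iff, Set.mem_ofPred_eq, not_not] at hω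
  exact Set.mem_biUnion (x := atomOf m ω) ⟨⟨ω, rfl⟩, hω⟩ (mem_atomOf m ω)

end Atoms

/-! ### Atoms of a regular filtration and their weights -/

section Weights

variable {Ω : Type*} {m0 : MeasurableSpace Ω} {𝕜 : Type*} [RCLike 𝕜]
  {P : Measure Ω} {𝓕 : Filtration ℕ m0}

/-- The martingale difference `u_{k+1} - u_k`. -/
def mdiff (P : Measure Ω) (𝓕 : Filtration ℕ m0) (u : Ω → 𝕜) (k : ℕ) (ω : Ω) : 𝕜 :=
  mart P 𝓕 u (k + 1) ω - mart P 𝓕 u k ω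

lemma measurable_mart_filtration (u : Ω → 𝕜) (k : ℕ) : Measurable[𝓕 k] (mart P 𝓕 u k) := by
  cases k with
  | zero => exact measurable_const
  | succ k => exact stronglyMeasurable_condExp.measurable

lemma measurable_mdiff (u : Ω → 𝕜) (k : ℕ) : Measurable (mdiff P 𝓕 u k) :=
  (measurable_mart u (k + 1)).sub (measurable_mart u k)

lemma measurable_mdiff_filtration (u : Ω → 𝕜) (k : ℕ) :
    Measurable[𝓕 (k + 1)] (mdiff P 𝓕 u k) :=
  (measurable_mart_filtration u (k + 1)).sub
    ((measurable_mart_filtration u k).mono (𝓕.mono k.le_succ) le_rfl)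

lemma integrable_mart (u : Ω → 𝕜) (k : ℕ) : Integrable (mart P 𝓕 u k) P := by
  cases k with
  | zero => exact integrable_zero _ _ _
  | succ k => exact integrable_condExp

lemma integrable_mdiff (u : Ω → 𝕜) (k : ℕ) : Integrable (mdiff P 𝓕 u k) P :=
  (integrable_mart u (k + 1)).sub (integrable_mart u k)

lemma mart_eq_sum (u : Ω → 𝕜) (n : ℕ) (ω : Ω) :
    mart P 𝓕 u n ω = ∑ k ∈ Finset.range n, mdiff P 𝓕 u k ω := by
  simp only [mdiff]
  rw [Finset.sum_range_sub fun k => mart P 𝓕 u k ω]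
  simp [mart]

/-- The weights `w_k`: for `k ≥ 1` the measure of the atom of `𝓕 k` containing the point. The value
`w_0 = C` makes the step from `0` to `1` a strict decrease by the factor `1 - 1 / C`, as
`w_1 ≤ 1 ≤ C - 1`; so the first martingale difference needs no separate treatment. -/
def weight (P : Measure Ω) (𝓕 : Filtration ℕ m0) (C : ℝ) : ℕ → Ω → ℝ
  | 0, _ => C
  | k + 1, ω => P.real (atomOf (𝓕 (k + 1)) ω)

lemma ae_measure_atomOf_ne_zero (hatom : ∀ k, CountablyAtomic (𝓕 k)) :
    ∀ᵐ ω ∂P, ∀ k, P (atomOf (𝓕 k) ω) ≠ 0 :=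
  ae_all_iff.2 fun k => (hatom k).ae_measure_atomOf_ne_zero P

variable [IsProbabilityMeasure P]

/-- On an atom of positive measure, the conditional expectation is the average over the atom. -/
lemma setIntegral_atomOf_eq {m : MeasurableSpace Ω} (hm : CountablyAtomic m) (hle : m ≤ m0)
    {u : Ω → 𝕜} (hu : Integrable u P) (ω : Ω) :
    ∫ x in atomOf m ω, u x ∂P = P.real (atomOf m ω) • P[u | m] ω := by
  have hA := hm.measurableSet_atomOf ω
  rw [← setIntegral_condExp hle hu hA, ← setIntegral_const]
  refine setIntegral_congr_fun (hle _ hA) fun x hx => ?_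
  exact eq_of_mem_atomOf stronglyMeasurable_condExp.measurable hx

/-- Regularity with a constant `C ≥ 2`, so that the ratio `1 - 1 / C` lies in `(0, 1)`. -/
def RegularWith (P : Measure Ω) (𝓕 : Filtration ℕ m0) (C : ℝ) : Prop :=
  2 ≤ C ∧ ∀ k : ℕ, ∀ F : Set Ω, MeasurableSet[𝓕 (k + 1)] F →
    ∃ G : Set Ω, MeasurableSet[𝓕 k] G ∧ F ⊆ G ∧ P.real G ≤ C * P.real F

lemma IsRegular.exists_regularWith (h : IsRegular P 𝓕) : ∃ C, RegularWith P 𝓕 C := by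
  obtain ⟨C, hC, h⟩ := h
  refine ⟨max C 2, le_max_right _ _, fun k F hF => ?_⟩
  obtain ⟨G, hG, hFG, hP⟩ := h k F hF
  refine ⟨G, hG, hFG, ?_⟩
  have h1 : P.real G ≤ C * P.real F := by
    have := ENNReal.toReal_mono (ENNReal.mul_ne_top ENNReal.ofReal_ne_top (measure_ne_top P F)) hP
    rwa [ENNReal.toReal_mul, ENNReal.toReal_ofReal hC.le] at this
  exact h1.trans (by gcongr; exact le_max_left _ _)

lemma RegularWith.real_atomOf_le {C : ℝ} (h : RegularWith P 𝓕 C)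
    (hatom : ∀ k, CountablyAtomic (𝓕 k)) (k : ℕ) (ω : Ω) :
    P.real (atomOf (𝓕 k) ω) ≤ C * P.real (atomOf (𝓕 (k + 1)) ω) := by
  obtain ⟨G, hG, hFG, hP⟩ := h.2 k _ ((hatom (k + 1)).measurableSet_atomOf ω)
  exact (measureReal_mono (atomOf_subset hG (hFG (mem_atomOf _ ω)))).trans hP

/-- An atom either keeps its measure in the next generation or loses a fixed proportion of it:
regularity is applied to the difference of the two atoms. -/
lemma RegularWith.real_atomOf_eq_or_le {C : ℝ} (h : RegularWith P 𝓕 C)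
    (hatom : ∀ k, CountablyAtomic (𝓕 k)) (k : ℕ) (ω : Ω) :
    P.real (atomOf (𝓕 (k + 1)) ω) = P.real (atomOf (𝓕 k) ω) ∨
      P.real (atomOf (𝓕 (k + 1)) ω) ≤ (1 - 1 / C) * P.real (atomOf (𝓕 k) ω) := by
  set A := atomOf (𝓕 k) ω with hA
  set A' := atomOf (𝓕 (k + 1)) ω with hA'
  have hsub : A' ⊆ A := atomOf_anti (𝓕.mono k.le_succ) ω
  have hmA : MeasurableSet[𝓕 (k + 1)] A := 𝓕.mono k.le_succ _ ((hatom k).measurableSet_atomOf ω)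
  have hmA' : MeasurableSet[𝓕 (k + 1)] A' := (hatom (k + 1)).measurableSet_atomOf ω
  have hdiff : P.real (A \ A') = P.real A - P.real A' :=
    measureReal_sdiff hsub (𝓕.le _ _ hmA')
  have hC : 0 < C := by linarith [h.1]
  rcases Set.eq_empty_or_nonempty (A \ A') with he | ⟨x, hx⟩
  · left
    rw [he, measureReal_empty] at hdiff
    linarith
  · right
    obtain ⟨G, hG, hFG, hP⟩ := h.2 k _ (hmA.diff hmA')
    have hxG : A ⊆ G := by
      have := atomOf_subset hG (hFG hx)
      rwa [atomOf_eq_of_mem hx.1] at this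
    have h1 : P.real A ≤ C * (P.real A - P.real A') := hdiff ▸ (measureReal_mono hxG).trans hP
    have h2 : P.real A / C ≤ P.real A - P.real A' := by
      rw [div_le_iff₀ hC]
      linarith
    have h3 : (1 - 1 / C) * P.real A = P.real A - P.real A / C := by ring
    linarith

/-- If an atom of generation `k ≥ 1` keeps its measure in the next generation, then all martingale
differences vanish there. -/
lemma mdiff_eq_zero_of_real_atomOf_eq (hatom : ∀ k, CountablyAtomic (𝓕 k)) {u : Ω → 𝕜}
    (hu : Integrable u P) {k : ℕ} {ω : Ω} (hpos : P (atomOf (𝓕 (k + 2)) ω) ≠ 0)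
    (h : P.real (atomOf (𝓕 (k + 2)) ω) = P.real (atomOf (𝓕 (k + 1)) ω)) :
    mdiff P 𝓕 u (k + 1) ω = 0 := by
  have hsub : atomOf (𝓕 (k + 2)) ω ⊆ atomOf (𝓕 (k + 1)) ω := atomOf_anti (𝓕.mono (k + 1).le_succ) ω
  have hae : atomOf (𝓕 (k + 2)) ω =ᵐ[P] atomOf (𝓕 (k + 1)) ω := by
    refine ae_eq_of_subset_of_measure_ge hsub ?_
      (𝓕.le _ _ ((hatom (k + 2)).measurableSet_atomOf ω)).nullMeasurableSet (measure_ne_top _ _)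
    exact ((ENNReal.toReal_eq_toReal_iff' (measure_ne_top _ _) (measure_ne_top _ _)).1 h).ge
  have h1 := setIntegral_atomOf_eq (hatom (k + 2)) (𝓕.le _) hu ω
  have h2 := setIntegral_atomOf_eq (hatom (k + 1)) (𝓕.le _) hu ω
  rw [setIntegral_congr_set hae, h2, ← h] at h1
  have hne : P.real (atomOf (𝓕 (k + 2)) ω) ≠ 0 :=
    (ENNReal.toReal_ne_zero).2 ⟨hpos, measure_ne_top _ _⟩
  exact sub_eq_zero.2 (smul_right_injective 𝕜 hne h1).symm

lemma weight_pos {C : ℝ} (hC : 2 ≤ C) {ω : Ω} (hω : ∀ k, P (atomOf (𝓕 k) ω) ≠ 0) (k : ℕ) :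
    0 < weight P 𝓕 C k ω := by
  cases k with
  | zero => change 0 < C; linarith
  | succ k => exact ENNReal.toReal_pos (hω _) (measure_ne_top _ _)

lemma weight_antitone {C : ℝ} (hC : 2 ≤ C) (ω : Ω) : Antitone fun k => weight P 𝓕 C k ω := by
  refine antitone_nat_of_succ_le fun k => ?_
  cases k with
  | zero => exact measureReal_le_one.trans (by change 1 ≤ C; linarith)
  | succ k => exact measureReal_mono (atomOf_anti (𝓕.mono (k + 1).le_succ) ω)

lemma weight_le_or_mdiff_eq_zero {C : ℝ} (h : RegularWith P 𝓕 C)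
    (hatom : ∀ k, CountablyAtomic (𝓕 k)) {ω : Ω} (hω : ∀ k, P (atomOf (𝓕 k) ω) ≠ 0) {u : Ω → 𝕜}
    (hu : Integrable u P) (k : ℕ) :
    mdiff P 𝓕 u k ω = 0 ∨ weight P 𝓕 C (k + 1) ω ≤ (1 - 1 / C) * weight P 𝓕 C k ω := by
  have hC := h.1
  cases k with
  | zero =>
    right
    have h1 : (1 - 1 / C) * C = C - 1 := by field_simp
    refine measureReal_le_one.trans ?_
    change 1 ≤ (1 - 1 / C) * C
    linarith
  | succ k =>
    rcases h.real_atomOf_eq_or_le hatom (k + 1) ω with h1 | h1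
    · exact Or.inl (mdiff_eq_zero_of_real_atomOf_eq hatom hu (hω _) h1)
    · exact Or.inr h1

end Weights

/-! ### Two summation lemmas for geometrically decreasing weights -/

section Sequences

lemma rpow_telescope {x y ρ α M e : ℝ} (hy : 0 < y) (hyx : y ≤ x) (hρ0 : 0 < ρ) (hρ1 : ρ < 1)
    (hα : 0 < α) (hM : 0 ≤ M) (he : e ≤ M * y ^ α) (h : e = 0 ∨ y ≤ ρ * x) :
    e ≤ M / (1 - ρ ^ α) * (x ^ α - y ^ α) := by
  have hx : 0 < x := hy.trans_le hyx
  have hρ : ρ ^ α < 1 := Real.rpow_lt_one hρ0.le hρ1 hα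
  have hxy : y ^ α ≤ x ^ α := Real.rpow_le_rpow hy.le hyx hα.le
  have hc : 0 ≤ M / (1 - ρ ^ α) := div_nonneg hM (by linarith)
  rcases h with h | h
  · rw [h]
    exact mul_nonneg hc (by linarith)
  · have h1 : y ^ α ≤ ρ ^ α * x ^ α := by
      rw [← Real.mul_rpow hρ0.le hx.le]
      exact Real.rpow_le_rpow hy.le h hα.le
    have h2 : (1 - ρ ^ α) * y ^ α ≤ x ^ α - y ^ α := by
      nlinarith [Real.rpow_nonneg hy.le α]
    calc e ≤ M * y ^ α := he
      _ = M / (1 - ρ ^ α) * ((1 - ρ ^ α) * y ^ α) := by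
        have : 1 - ρ ^ α ≠ 0 := by linarith
        field_simp
      _ ≤ _ := by gcongr

/-- A sequence dominated by the weights, and supported on the steps where the weights drop by the
factor `ρ`, has sums controlled by the first weight. -/
lemma sum_le_of_weight {x e : ℕ → ℝ} {ρ α M : ℝ} (hx : ∀ k, 0 < x k) (hanti : Antitone x)
    (hρ0 : 0 < ρ) (hρ1 : ρ < 1) (hα : 0 < α) (hM : 0 ≤ M)
    (he : ∀ k, e k ≤ M * x (k + 1) ^ α) (h : ∀ k, e k = 0 ∨ x (k + 1) ≤ ρ * x k) (j n : ℕ) :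
    ∑ i ∈ Finset.range n, e (j + i) ≤ M / (1 - ρ ^ α) * x j ^ α := by
  have hρ : ρ ^ α < 1 := Real.rpow_lt_one hρ0.le hρ1 hα
  calc ∑ i ∈ Finset.range n, e (j + i)
      ≤ ∑ i ∈ Finset.range n, M / (1 - ρ ^ α) * (x (j + i) ^ α - x (j + (i + 1)) ^ α) :=
        Finset.sum_le_sum fun i _ =>
          rpow_telescope (hx _) (hanti (by omega)) hρ0 hρ1 hα hM (he _) (h _)
    _ = M / (1 - ρ ^ α) * (x j ^ α - x (j + n) ^ α) := by
        rw [← Finset.mul_sum, Finset.sum_range_sub' fun i => x (j + i) ^ α]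
        simp
    _ ≤ _ := by
        refine mul_le_mul_of_nonneg_left ?_ (div_nonneg hM (by linarith))
        linarith [Real.rpow_nonneg (hx (j + n)).le α]

/-- The function `θ u = u ^ β / (1 + u ^ β)`, which increases from `0` to `1`, grows from `v` to
`u ≥ v / ρ` by at least a multiple of `v ^ β / (1 + v ^ β) ^ 2`. -/
lemma theta_step {u v ρ β : ℝ} (hv : 0 < v) (hρ0 : 0 < ρ) (hρ1 : ρ < 1) (hβ : 0 < β)
    (h : v ≤ ρ * u) :
    (1 - ρ ^ β) * (v ^ β / (1 + v ^ β) ^ 2) ≤ u ^ β / (1 + u ^ β) - v ^ β / (1 + v ^ β) := by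
  have hu : 0 < u := by
    by_contra hu
    nlinarith
  have hρ : ρ ^ β < 1 := Real.rpow_lt_one hρ0.le hρ1 hβ
  have hr0 : 0 < ρ ^ β := Real.rpow_pos_of_pos hρ0 β
  have h1 : v ^ β ≤ ρ ^ β * u ^ β := by
    rw [← Real.mul_rpow hρ0.le hu.le]
    exact Real.rpow_le_rpow hv.le h hβ.le
  have hb : 0 < v ^ β := Real.rpow_pos_of_pos hv β
  have ha : 0 < u ^ β := Real.rpow_pos_of_pos hu β
  generalize u ^ β = a at *
  generalize v ^ β = b at *
  generalize ρ ^ β = r at *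
  have h2 : a / (1 + a) - b / (1 + b) = (a - b) / ((1 + a) * (1 + b)) := by
    field_simp
    ring
  rw [h2, ← mul_div_assoc, div_le_div_iff₀ (by positivity) (by positivity)]
  have hrb : b ≤ r * a := h1
  have hba : b ≤ a := by nlinarith
  have key : (1 - r) * b * (1 + a) ≤ (a - b) * (1 + b) := by
    nlinarith [mul_pos ha hb, mul_pos hr0 ha]
  calc (1 - r) * b * ((1 + a) * (1 + b)) = ((1 - r) * b * (1 + a)) * (1 + b) := by ring
    _ ≤ ((a - b) * (1 + b)) * (1 + b) := by gcongr
    _ = _ := by ring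

lemma min_rpow_le_theta {v α β : ℝ} (hv : 0 < v) (hβ : 0 < β) (hβα : β ≤ α) (hβ1 : β ≤ 1) :
    min (v ^ α) v⁻¹ ≤ 4 * (v ^ β / (1 + v ^ β) ^ 2) := by
  have hb : 0 < v ^ β := Real.rpow_pos_of_pos hv β
  rcases le_total v 1 with h | h
  · refine (min_le_left _ _).trans ((Real.rpow_le_rpow_of_exponent_ge hv h hβα).trans ?_)
    have hb1 : v ^ β ≤ 1 := Real.rpow_le_one hv.le h hβ.le
    rw [← mul_div_assoc, le_div_iff₀ (by positivity)]
    nlinarith [mul_nonneg hb.le (sub_nonneg.2 hb1), mul_pos hb hb]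
  · have hb1 : 1 ≤ v ^ β := Real.one_le_rpow h hβ.le
    have h1 : v⁻¹ ≤ (v ^ β)⁻¹ := by
      gcongr
      simpa using Real.rpow_le_rpow_of_exponent_le h hβ1
    refine (min_le_right _ _).trans (h1.trans ?_)
    rw [← mul_div_assoc, le_div_iff₀ (by positivity), inv_mul_le_iff₀ hb]
    nlinarith

/-- The two bounds `d_k ≤ S` and `d_k ^ p * x_{k+1} ≤ m` say that `d_k * x_{k+1} ^ α` is at most
`S ^ p * m ^ α * min (u ^ α) u⁻¹`, `u = x_{k+1} / t`, where the two bounds agree at the weight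
`t = m / S ^ p`. As the weights decrease geometrically, the sum over `k` is a multiple of
`S ^ p * m ^ α`: the summands are dominated by increments of the bounded function `θ`. -/
lemma sum_mul_weight_le {x d : ℕ → ℝ} {ρ α p S m : ℝ} (hx : ∀ k, 0 < x k) (hanti : Antitone x)
    (hρ0 : 0 < ρ) (hρ1 : ρ < 1) (hp : 0 < p) (hα : α = 1 / p - 1) (hα0 : 0 < α) (hS : 0 ≤ S)
    (hm : 0 ≤ m) (hd0 : ∀ k, 0 ≤ d k) (hdS : ∀ k, d k ≤ S) (hdm : ∀ k, d k ^ p * x (k + 1) ≤ m)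
    (h : ∀ k, d k = 0 ∨ x (k + 1) ≤ ρ * x k) (n : ℕ) :
    ∑ k ∈ Finset.range n, d k * x (k + 1) ^ α ≤ 4 / (1 - ρ ^ min α 1) * (S ^ p * m ^ α) := by
  set β := min α 1 with hβdef
  have hβ : 0 < β := lt_min hα0 one_pos
  have hρβ : ρ ^ β < 1 := Real.rpow_lt_one hρ0.le hρ1 hβ
  have hK : 0 ≤ 4 / (1 - ρ ^ β) := div_nonneg (by norm_num) (by linarith)
  have hpα : p + p * α = 1 := by
    rw [hα]
    field_simp
    ring
  by_cases hSm : S = 0 ∨ m = 0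
  · have hd : ∀ k, d k = 0 := by
      intro k
      rcases hSm with h0 | h0
      · exact le_antisymm (h0 ▸ hdS k) (hd0 k)
      · have h1 : d k ^ p = 0 := by
          refine le_antisymm ?_ (Real.rpow_nonneg (hd0 k) p)
          by_contra! h2
          exact absurd (hdm k) (not_le.2 (h0 ▸ mul_pos h2 (hx _)))
        exact (Real.rpow_eq_zero (hd0 k) hp.ne').1 h1
    simp only [hd, zero_mul, Finset.sum_const_zero]
    positivity
  · push Not at hSm
    have hS0 : 0 < S := lt_of_le_of_ne hS (Ne.symm hSm.1)
    have hm0 : 0 < m := lt_of_le_of_ne hm (Ne.symm hSm.2)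
    set D := S ^ p * m ^ α with hD
    have hD0 : 0 < D := by positivity
    set t := m / S ^ p with ht
    have ht0 : 0 < t := by positivity
    have hbound : ∀ k, d k * x (k + 1) ^ α ≤ D * min ((x (k + 1) / t) ^ α) (x (k + 1) / t)⁻¹ := by
      intro k
      have hy := hx (k + 1)
      rw [mul_min_of_nonneg _ _ hD0.le]
      refine le_min ?_ ?_
      · have h1 : D * (x (k + 1) / t) ^ α = S * x (k + 1) ^ α := by
          rw [Real.div_rpow hy.le ht0.le, ht, Real.div_rpow hm (by positivity), hD,
            ← Real.rpow_mul hS]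
          have h2 : S ^ p * S ^ (p * α) = S := by
            rw [← Real.rpow_add hS0, hpα, Real.rpow_one]
          have h3 : m ^ α ≠ 0 := by positivity
          field_simp
          linear_combination h2
        rw [h1]
        exact mul_le_mul_of_nonneg_right (hdS k) (by positivity)
      · have h1 : D * (x (k + 1) / t)⁻¹ = m ^ (1 / p) * (x (k + 1))⁻¹ := by
          have h2 : m ^ (1 / p) = m ^ α * m := by
            rw [← Real.rpow_add_one hm0.ne', hα, sub_add_cancel]
          have h3 : S ^ p ≠ 0 := by positivity
          rw [h2, hD, ht]
          field_simp
        have h4 : d k ≤ m ^ (1 / p) * (x (k + 1)) ^ (-(1 / p)) := by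
          have h5 : d k ^ p ≤ m / x (k + 1) := (le_div_iff₀ hy).2 (hdm k)
          have h6 := Real.rpow_le_rpow (Real.rpow_nonneg (hd0 k) p) h5 (one_div_pos.2 hp).le
          rwa [← Real.rpow_mul (hd0 k), mul_one_div_cancel hp.ne', Real.rpow_one,
            Real.div_rpow hm hy.le, div_eq_mul_inv, ← Real.rpow_neg hy.le] at h6
        rw [h1]
        calc d k * x (k + 1) ^ α
            ≤ m ^ (1 / p) * (x (k + 1)) ^ (-(1 / p)) * x (k + 1) ^ α := by gcongr
          _ = m ^ (1 / p) * (x (k + 1))⁻¹ := by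
            rw [mul_assoc, ← Real.rpow_add hy, ← Real.rpow_neg_one, hα]
            congr 2
            ring
    have hstep : ∀ k, d k * x (k + 1) ^ α ≤ 4 / (1 - ρ ^ β) * D *
        ((x k / t) ^ β / (1 + (x k / t) ^ β) - (x (k + 1) / t) ^ β / (1 + (x (k + 1) / t) ^ β)) := by
      intro k
      have hu : 0 < x k / t := div_pos (hx k) ht0
      have hv : 0 < x (k + 1) / t := div_pos (hx _) ht0
      rcases h k with h0 | h0
      · rw [h0, zero_mul]
        refine mul_nonneg (by positivity) (sub_nonneg.2 ?_)
        have h1 : (x (k + 1) / t) ^ β ≤ (x k / t) ^ β := by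
          refine Real.rpow_le_rpow hv.le ?_ hβ.le
          exact div_le_div_of_nonneg_right (hanti k.le_succ) ht0.le
        have h2 : 0 < (x (k + 1) / t) ^ β := by positivity
        rw [div_le_div_iff₀ (by positivity) (by positivity)]
        nlinarith
      · have h1 := theta_step hv hρ0 hρ1 hβ (u := x k / t) (by
          rw [← mul_div_assoc]
          exact div_le_div_of_nonneg_right h0 ht0.le)
        have h2 := min_rpow_le_theta hv hβ (min_le_left α 1) (min_le_right α 1)
        have h3 : 1 - ρ ^ β ≠ 0 := by linarith
        calc d k * x (k + 1) ^ α
            ≤ D * (4 * ((x (k + 1) / t) ^ β / (1 + (x (k + 1) / t) ^ β) ^ 2)) :=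
              (hbound k).trans (by gcongr)
          _ = 4 / (1 - ρ ^ β) * D * ((1 - ρ ^ β) *
              ((x (k + 1) / t) ^ β / (1 + (x (k + 1) / t) ^ β) ^ 2)) := by
              field_simp
          _ ≤ _ := by gcongr
    refine (Finset.sum_le_sum fun k _ => hstep k).trans ?_
    rw [← Finset.mul_sum, Finset.sum_range_sub' fun k => (x k / t) ^ β / (1 + (x k / t) ^ β)]
    have h0 : 0 < (x 0 / t) ^ β := Real.rpow_pos_of_pos (div_pos (hx 0) ht0) _
    have hn : 0 < (x n / t) ^ β := Real.rpow_pos_of_pos (div_pos (hx n) ht0) _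
    have h1 : (x 0 / t) ^ β / (1 + (x 0 / t) ^ β) ≤ 1 := (div_le_one (by positivity)).2 (by linarith)
    have h2 : 0 ≤ (x n / t) ^ β / (1 + (x n / t) ^ β) := by positivity
    calc _ ≤ 4 / (1 - ρ ^ β) * D * 1 :=
          mul_le_mul_of_nonneg_left (by linarith) (by positivity)
      _ = _ := mul_one _

end Sequences

section Bounds

variable {Ω : Type*} {m0 : MeasurableSpace Ω} {𝕜 : Type*} [RCLike 𝕜]
  {P : Measure Ω} [IsProbabilityMeasure P] {𝓕 : Filtration ℕ m0}

/-! ### Martingale differences of Lipschitz functions -/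

lemma setLIntegral_le_lipENorm {α : ℝ} {g : Ω → 𝕜} {n : ℕ} {A : Set Ω}
    (hA : MeasurableSet[𝓕 n] A) (h0 : P A ≠ 0) :
    ∫⁻ ω in A, ‖g ω - mart P 𝓕 g n ω‖ₑ ∂P ≤ P A ^ (1 + α) * lipENorm P 𝓕 α g := by
  have h : P A ^ (-1 - α) * ∫⁻ ω in A, ‖g ω - mart P 𝓕 g n ω‖ₑ ∂P ≤ lipENorm P 𝓕 α g :=
    le_iSup_of_le n (le_iSup_of_le A (le_iSup_of_le hA le_rfl))
  calc ∫⁻ ω in A, ‖g ω - mart P 𝓕 g n ω‖ₑ ∂P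
      = P A ^ (1 + α) * (P A ^ (-1 - α) * ∫⁻ ω in A, ‖g ω - mart P 𝓕 g n ω‖ₑ ∂P) := by
        rw [← mul_assoc, ← ENNReal.rpow_add _ _ h0 (measure_ne_top P A)]
        simp
    _ ≤ _ := by gcongr

/-- The constant in `∑_{k ≥ j} |g_{k+1} - g_k| ≤ lipConst C α * ‖g‖ * w_j ^ α`. -/
def lipConst (C α : ℝ) : ℝ := C ^ (1 + α) / (1 - (1 - 1 / C) ^ α)

lemma ratio_pos {C : ℝ} (hC : 2 ≤ C) : 0 < 1 - 1 / C := by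
  rw [sub_pos, div_lt_one (by linarith)]
  linarith

lemma ratio_lt_one {C : ℝ} (hC : 2 ≤ C) : 1 - 1 / C < 1 := by
  have : 0 < 1 / C := by positivity
  linarith

lemma rpow_le_lipConst {C α : ℝ} (hC : 2 ≤ C) (hα : 0 < α) : C ^ (1 + α) ≤ lipConst C α := by
  have h1 := Real.rpow_lt_one (ratio_pos hC).le (ratio_lt_one hC) hα
  have h2 := Real.rpow_nonneg (ratio_pos hC).le α
  exact le_div_self (by positivity) (by linarith) (by linarith)

lemma lipConst_nonneg {C α : ℝ} (hC : 2 ≤ C) (hα : 0 < α) : 0 ≤ lipConst C α :=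
  le_trans (by positivity) (rpow_le_lipConst hC hα)

lemma norm_mdiff_le {C α : ℝ} (hreg : RegularWith P 𝓕 C) (hatom : ∀ k, CountablyAtomic (𝓕 k))
    (hα : 0 < α) {g : Ω → 𝕜} (hg : Integrable g P) (hL : lipENorm P 𝓕 α g ≠ ∞) {ω : Ω}
    (hω : ∀ k, P (atomOf (𝓕 k) ω) ≠ 0) (k : ℕ) :
    ‖mdiff P 𝓕 g k ω‖ ≤
      C ^ (1 + α) * (lipENorm P 𝓕 α g).toReal * weight P 𝓕 C (k + 1) ω ^ α := by
  set A := atomOf (𝓕 (k + 1)) ω with hA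
  set A₀ := atomOf (𝓕 k) ω with hA₀
  have hC := hreg.1
  have hsub : A ⊆ A₀ := atomOf_anti (𝓕.mono k.le_succ) ω
  have hmA : MeasurableSet[𝓕 (k + 1)] A := (hatom (k + 1)).measurableSet_atomOf ω
  have hpos : 0 < P.real A := ENNReal.toReal_pos (hω _) (measure_ne_top _ _)
  have h1 : ∫ x in A, (g x - mart P 𝓕 g k x) ∂P = P.real A • mdiff P 𝓕 g k ω := by
    rw [integral_sub hg.integrableOn (integrable_mart g k).integrableOn,
      setIntegral_atomOf_eq (hatom (k + 1)) (𝓕.le _) hg ω]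
    have h2 : ∫ x in A, mart P 𝓕 g k x ∂P = P.real A • mart P 𝓕 g k ω := by
      rw [← setIntegral_const]
      exact setIntegral_congr_fun (𝓕.le _ _ hmA) fun x hx =>
        eq_of_mem_atomOf (measurable_mart_filtration g k) (hsub hx)
    rw [h2, ← smul_sub]
    rfl
  have h2 : ‖∫ x in A, (g x - mart P 𝓕 g k x) ∂P‖ ≤
      P.real A₀ ^ (1 + α) * (lipENorm P 𝓕 α g).toReal := by
    have h3 : ‖∫ x in A, (g x - mart P 𝓕 g k x) ∂P‖ₑ ≤ P A₀ ^ (1 + α) * lipENorm P 𝓕 α g :=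
      (enorm_integral_le_lintegral_enorm _).trans <| (lintegral_mono_set hsub).trans <|
        setLIntegral_le_lipENorm ((hatom k).measurableSet_atomOf ω) (hω k)
    have h4 := ENNReal.toReal_mono (ENNReal.mul_ne_top
      (ENNReal.rpow_ne_top_of_nonneg (by linarith) (measure_ne_top P A₀)) hL) h3
    rwa [toReal_enorm, ENNReal.toReal_mul, ← ENNReal.toReal_rpow] at h4
  have h3 : P.real A₀ ^ (1 + α) ≤ C ^ (1 + α) * (P.real A ^ α * P.real A) := by
    rw [← Real.rpow_add_one hpos.ne', add_comm α 1, ← Real.mul_rpow (by linarith) hpos.le]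
    exact Real.rpow_le_rpow measureReal_nonneg (hreg.real_atomOf_le hatom k ω) (by linarith)
  rw [h1, norm_smul, Real.norm_of_nonneg hpos.le] at h2
  refine le_of_mul_le_mul_left ?_ hpos
  calc P.real A * ‖mdiff P 𝓕 g k ω‖ ≤ P.real A₀ ^ (1 + α) * (lipENorm P 𝓕 α g).toReal := h2
    _ ≤ C ^ (1 + α) * (P.real A ^ α * P.real A) * (lipENorm P 𝓕 α g).toReal := by gcongr
    _ = P.real A * (C ^ (1 + α) * (lipENorm P 𝓕 α g).toReal * P.real A ^ α) := by ring

lemma sum_norm_mdiff_le {C α : ℝ} (hreg : RegularWith P 𝓕 C)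
    (hatom : ∀ k, CountablyAtomic (𝓕 k)) (hα : 0 < α) {g : Ω → 𝕜} (hg : Integrable g P)
    (hL : lipENorm P 𝓕 α g ≠ ∞) {ω : Ω} (hω : ∀ k, P (atomOf (𝓕 k) ω) ≠ 0) (j n : ℕ) :
    ∑ i ∈ Finset.range n, ‖mdiff P 𝓕 g (j + i) ω‖ ≤
      lipConst C α * (lipENorm P 𝓕 α g).toReal * weight P 𝓕 C j ω ^ α := by
  have hC := hreg.1
  have h := sum_le_of_weight (x := fun k => weight P 𝓕 C k ω) (e := fun k => ‖mdiff P 𝓕 g k ω‖)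
    (weight_pos hC hω) (weight_antitone hC ω) (ratio_pos hC) (ratio_lt_one hC) hα
    (M := C ^ (1 + α) * (lipENorm P 𝓕 α g).toReal) (by positivity)
    (norm_mdiff_le hreg hatom hα hg hL hω)
    (fun k => (weight_le_or_mdiff_eq_zero hreg hatom hω hg k).imp_left fun h => by simp [h]) j n
  refine h.trans_eq ?_
  rw [lipConst, mul_div_right_comm]

lemma tsum_enorm_mdiff_le {C α : ℝ} (hreg : RegularWith P 𝓕 C)
    (hatom : ∀ k, CountablyAtomic (𝓕 k)) (hα : 0 < α) {g : Ω → 𝕜} (hg : Integrable g P)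
    (hL : lipENorm P 𝓕 α g ≠ ∞) {ω : Ω} (hω : ∀ k, P (atomOf (𝓕 k) ω) ≠ 0) (j : ℕ) :
    ∑' i, ‖mdiff P 𝓕 g (j + i) ω‖ₑ ≤
      ENNReal.ofReal (lipConst C α * (lipENorm P 𝓕 α g).toReal * weight P 𝓕 C j ω ^ α) := by
  refine ENNReal.tsum_le_of_sum_range_le fun n => ?_
  simp only [← ofReal_norm]
  rw [← ENNReal.ofReal_sum_of_nonneg fun _ _ => norm_nonneg _]
  exact ENNReal.ofReal_le_ofReal (sum_norm_mdiff_le hreg hatom hα hg hL hω j n)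

/-- The constant in `‖g‖_∞ ≤ supConst C α * ‖g‖_{Λ_1(α)}`. -/
def supConst (C α : ℝ) : ℝ := lipConst C α * C ^ α

lemma supConst_nonneg {C α : ℝ} (hC : 2 ≤ C) (hα : 0 < α) : 0 ≤ supConst C α :=
  mul_nonneg (lipConst_nonneg hC hα) (by positivity)

lemma norm_mart_le {C α : ℝ} (hreg : RegularWith P 𝓕 C)
    (hatom : ∀ k, CountablyAtomic (𝓕 k)) (hα : 0 < α) {g : Ω → 𝕜} (hg : Integrable g P)
    (hL : lipENorm P 𝓕 α g ≠ ∞) {ω : Ω} (hω : ∀ k, P (atomOf (𝓕 k) ω) ≠ 0) (n : ℕ) :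
    ‖mart P 𝓕 g n ω‖ ≤ supConst C α * (lipENorm P 𝓕 α g).toReal := by
  rw [mart_eq_sum]
  refine (norm_sum_le _ _).trans ?_
  have h := sum_norm_mdiff_le hreg hatom hα hg hL hω 0 n
  simp only [zero_add] at h
  refine h.trans_eq ?_
  rw [supConst, mul_right_comm]
  rfl

omit [IsProbabilityMeasure P] in
/-- Lévy's upward theorem, applied to the real and imaginary parts. -/
lemma ae_tendsto_mart [IsFiniteMeasure P] (hgen : ⨆ k, 𝓕 k = m0) {g : Ω → 𝕜}
    (hg : Integrable g P) :
    ∀ᵐ ω ∂P, Filter.Tendsto (fun n => mart P 𝓕 g n ω) Filter.atTop (nhds (g ω)) := by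
  have key : ∀ T : 𝕜 →L[ℝ] ℝ, ∀ᵐ ω ∂P,
      Filter.Tendsto (fun n => T (mart P 𝓕 g n ω)) Filter.atTop (nhds (T (g ω))) := by
    intro T
    have h1 : ∀ᵐ ω ∂P, ∀ n, T (P[g | 𝓕 n] ω) = P[T ∘ g | 𝓕 n] ω :=
      ae_all_iff.2 fun n => T.comp_condExp_comm hg
    have hTg : Integrable (T ∘ g) P := T.integrable_comp hg
    have h2 : P[T ∘ g | ⨆ n, 𝓕 n] =ᵐ[P] T ∘ g := by
      rw [hgen]
      exact condExp_of_aestronglyMeasurable' le_rfl hTg.1 hTg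
    filter_upwards [h1, h2, tendsto_ae_condExp (ℱ := 𝓕) (μ := P) (T ∘ g)] with ω h1 h2 h3
    rw [h2] at h3
    refine h3.congr' ?_
    filter_upwards [Filter.eventually_ge_atTop 1] with n hn
    obtain ⟨k, rfl⟩ := Nat.exists_eq_add_of_le' hn
    exact (h1 _).symm
  filter_upwards [key RCLike.reCLM, key RCLike.imCLM] with ω hre him
  have h := (RCLike.continuous_ofReal (K := 𝕜).tendsto _).comp hre
  have h' := ((RCLike.continuous_ofReal (K := 𝕜).tendsto _).comp him).mul_const (RCLike.I : 𝕜)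
  simpa [Function.comp_def, RCLike.re_add_im] using h.add h'

lemma ae_norm_le_of_lip {C α : ℝ} (hreg : RegularWith P 𝓕 C)
    (hatom : ∀ k, CountablyAtomic (𝓕 k)) (hgen : ⨆ k, 𝓕 k = m0) (hα : 0 < α) {g : Ω → 𝕜}
    (hg : Integrable g P) (hL : lipENorm P 𝓕 α g ≠ ∞) :
    ∀ᵐ ω ∂P, ‖g ω‖ ≤ supConst C α * (lipENorm P 𝓕 α g).toReal := by
  filter_upwards [ae_measure_atomOf_ne_zero hatom, ae_tendsto_mart hgen hg] with ω hω h
  exact le_of_tendsto h.norm (Filter.Eventually.of_forall (norm_mart_le hreg hatom hα hg hL hω))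

/-! ### The key estimate for the martingale differences of Hardy functions -/

omit [IsProbabilityMeasure P] in
lemma enorm_mdiff_le_squareFn (f : Ω → 𝕜) (k : ℕ) (ω : Ω) :
    ‖mdiff P 𝓕 f k ω‖ₑ ≤ squareFn P 𝓕 f ω := by
  have h := ENNReal.le_tsum (f := fun k => ‖mdiff P 𝓕 f k ω‖ₑ ^ (2 : ℝ)) k
  have h1 := ENNReal.rpow_le_rpow h (z := 1 / 2) (by norm_num)
  rwa [← ENNReal.rpow_mul, show (2 : ℝ) * (1 / 2) = 1 by norm_num, ENNReal.rpow_one] at h1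

omit [IsProbabilityMeasure P] in
lemma enorm_mdiff_rpow_mul_le (hatom : ∀ k, CountablyAtomic (𝓕 k)) {p : ℝ} (hp : 0 < p)
    (f : Ω → 𝕜) (k : ℕ) (ω : Ω) :
    ‖mdiff P 𝓕 f k ω‖ₑ ^ p * P (atomOf (𝓕 (k + 1)) ω) ≤ squareMoment P 𝓕 p f := by
  rw [← setLIntegral_const]
  refine le_trans ?_ (setLIntegral_le_lintegral (atomOf (𝓕 (k + 1)) ω) _)
  refine setLIntegral_mono' (𝓕.le _ _ ((hatom (k + 1)).measurableSet_atomOf ω)) fun x hx => ?_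
  rw [← eq_of_mem_atomOf (measurable_mdiff_filtration f k) hx]
  exact ENNReal.rpow_le_rpow (enorm_mdiff_le_squareFn f k x) hp.le

/-- The constant in `∑ |f_{k+1} - f_k| * w_{k+1} ^ α ≤ hardyConst C α * S(f) ^ p * ‖S(f)‖_p ^ (1-p)`. -/
def hardyConst (C α : ℝ) : ℝ := 4 / (1 - (1 - 1 / C) ^ min α 1)

lemma hardyConst_nonneg {C α : ℝ} (hC : 2 ≤ C) (hα : 0 < α) : 0 ≤ hardyConst C α := by
  have h1 := Real.rpow_lt_one (ratio_pos hC).le (ratio_lt_one hC) (lt_min hα one_pos)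
  exact div_nonneg (by norm_num) (by linarith)

/-- The sum `∑ |f_{k+1} - f_k| * w_{k+1} ^ α`, by which the paraproducts are controlled. -/
def weightedSum (P : Measure Ω) (𝓕 : Filtration ℕ m0) (C α : ℝ) (f : Ω → 𝕜) (ω : Ω) : ℝ≥0∞ :=
  ∑' k, ‖mdiff P 𝓕 f k ω‖ₑ * ENNReal.ofReal (weight P 𝓕 C (k + 1) ω ^ α)

lemma weightedSum_le {C p α : ℝ} (hreg : RegularWith P 𝓕 C)
    (hatom : ∀ k, CountablyAtomic (𝓕 k)) (hp : 0 < p) (hα : α = 1 / p - 1) (hα0 : 0 < α)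
    {f : Ω → 𝕜} (hf : Integrable f P) (hfm : squareMoment P 𝓕 p f ≠ ∞) {ω : Ω}
    (hω : ∀ k, P (atomOf (𝓕 k) ω) ≠ 0) (hS : squareFn P 𝓕 f ω ≠ ∞) :
    weightedSum P 𝓕 C α f ω ≤
      ENNReal.ofReal (hardyConst C α) * (squareFn P 𝓕 f ω ^ p * squareMoment P 𝓕 p f ^ α) := by
  have hC := hreg.1
  refine ENNReal.tsum_le_of_sum_range_le fun n => ?_
  have h := sum_mul_weight_le (x := fun k => weight P 𝓕 C k ω) (d := fun k => ‖mdiff P 𝓕 f k ω‖)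
    (S := (squareFn P 𝓕 f ω).toReal) (m := (squareMoment P 𝓕 p f).toReal)
    (weight_pos hC hω) (weight_antitone hC ω) (ratio_pos hC) (ratio_lt_one hC) hp hα hα0
    ENNReal.toReal_nonneg ENNReal.toReal_nonneg (fun _ => norm_nonneg _)
    (fun k => by
      rw [← toReal_enorm]
      exact ENNReal.toReal_mono hS (enorm_mdiff_le_squareFn f k ω))
    (fun k => by
      have := ENNReal.toReal_mono hfm (enorm_mdiff_rpow_mul_le hatom hp f k ω)
      rwa [ENNReal.toReal_mul, ← ENNReal.toReal_rpow, toReal_enorm] at this)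
    (fun k => (weight_le_or_mdiff_eq_zero hreg hatom hω hf k).imp_left fun h => by simp [h]) n
  have h1 := ENNReal.ofReal_le_ofReal h
  rw [ENNReal.ofReal_sum_of_nonneg fun k _ =>
    mul_nonneg (norm_nonneg _) (Real.rpow_nonneg (weight_pos hC hω _).le _)] at h1
  simp only [ENNReal.ofReal_mul (norm_nonneg _), ofReal_norm] at h1
  refine h1.trans_eq ?_
  change ENNReal.ofReal (hardyConst C α * _) = _
  rw [ENNReal.ofReal_mul (hardyConst_nonneg hC hα0),
    ENNReal.ofReal_mul (Real.rpow_nonneg ENNReal.toReal_nonneg _), ENNReal.toReal_rpow,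
    ENNReal.toReal_rpow, ENNReal.ofReal_toReal (ENNReal.rpow_ne_top_of_nonneg hp.le hS),
    ENNReal.ofReal_toReal (ENNReal.rpow_ne_top_of_nonneg hα0.le hfm)]

omit [IsProbabilityMeasure P] in
lemma ae_squareFn_ne_top {p : ℝ} (hp : 0 < p) {f : Ω → 𝕜} (hfm : squareMoment P 𝓕 p f ≠ ∞) :
    ∀ᵐ ω ∂P, squareFn P 𝓕 f ω ≠ ∞ := by
  filter_upwards [ae_lt_top ((measurable_squareFn f).pow_const p) hfm] with ω hω h
  rw [h, ENNReal.top_rpow_of_pos hp] at hω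
  exact lt_irrefl _ hω

lemma lintegral_weightedSum_le {C p α : ℝ} (hreg : RegularWith P 𝓕 C)
    (hatom : ∀ k, CountablyAtomic (𝓕 k)) (hp : 0 < p) (hα : α = 1 / p - 1) (hα0 : 0 < α)
    {f : Ω → 𝕜} (hf : Integrable f P) (hfm : squareMoment P 𝓕 p f ≠ ∞) :
    ∫⁻ ω, weightedSum P 𝓕 C α f ω ∂P ≤
      ENNReal.ofReal (hardyConst C α) * squareMoment P 𝓕 p f ^ (1 / p) := by
  calc ∫⁻ ω, weightedSum P 𝓕 C α f ω ∂P
      ≤ ∫⁻ ω, ENNReal.ofReal (hardyConst C α) *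
          (squareFn P 𝓕 f ω ^ p * squareMoment P 𝓕 p f ^ α) ∂P := by
        refine lintegral_mono_ae ?_
        filter_upwards [ae_measure_atomOf_ne_zero hatom, ae_squareFn_ne_top hp hfm] with ω hω hS
        exact weightedSum_le hreg hatom hp hα hα0 hf hfm hω hS
    _ = ENNReal.ofReal (hardyConst C α) * (squareMoment P 𝓕 p f ^ (1 : ℝ) *
          squareMoment P 𝓕 p f ^ α) := by
        rw [lintegral_const_mul' _ _ ENNReal.ofReal_ne_top,
          lintegral_mul_const' _ _ (ENNReal.rpow_ne_top_of_nonneg hα0.le hfm), ENNReal.rpow_one]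
        rfl
    _ = _ := by
        rw [← ENNReal.rpow_add_of_nonneg _ _ zero_le_one hα0.le, hα, add_sub_cancel]

/-! ### The three parts of the product -/

lemma tsum_enorm_mdiff_mul_mdiff_le {C α : ℝ} (hreg : RegularWith P 𝓕 C)
    (hatom : ∀ k, CountablyAtomic (𝓕 k)) (hα : 0 < α) (f : Ω → 𝕜) {g : Ω → 𝕜}
    (hg : Integrable g P) (hL : lipENorm P 𝓕 α g ≠ ∞) {ω : Ω}
    (hω : ∀ k, P (atomOf (𝓕 k) ω) ≠ 0) :
    ∑' k, ‖mdiff P 𝓕 f k ω * mdiff P 𝓕 g k ω‖ₑ ≤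
      ENNReal.ofReal (lipConst C α * (lipENorm P 𝓕 α g).toReal) * weightedSum P 𝓕 C α f ω := by
  rw [weightedSum, ← ENNReal.tsum_mul_left]
  refine ENNReal.tsum_le_tsum fun k => ?_
  have h : ‖mdiff P 𝓕 g k ω‖ₑ ≤ ENNReal.ofReal (lipConst C α * (lipENorm P 𝓕 α g).toReal) *
      ENNReal.ofReal (weight P 𝓕 C (k + 1) ω ^ α) := by
    have := lipConst_nonneg hreg.1 hα
    rw [← ofReal_norm, ← ENNReal.ofReal_mul (by positivity)]
    refine ENNReal.ofReal_le_ofReal ((norm_mdiff_le hreg hatom hα hg hL hω k).trans ?_)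
    have hw := (weight_pos hreg.1 hω (k + 1)).le
    gcongr
    exact rpow_le_lipConst hreg.1 hα
  rw [enorm_mul, mul_left_comm]
  gcongr

/-- Here `|f_k|` is bounded by the sum of its differences, and the sum over the differences of `g`
of higher order is carried out first; so no maximal function is needed. -/
lemma tsum_enorm_mart_mul_mdiff_le {C α : ℝ} (hreg : RegularWith P 𝓕 C)
    (hatom : ∀ k, CountablyAtomic (𝓕 k)) (hα : 0 < α) (f : Ω → 𝕜) {g : Ω → 𝕜}
    (hg : Integrable g P) (hL : lipENorm P 𝓕 α g ≠ ∞) {ω : Ω}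
    (hω : ∀ k, P (atomOf (𝓕 k) ω) ≠ 0) :
    ∑' k, ‖mart P 𝓕 f k ω * mdiff P 𝓕 g k ω‖ₑ ≤
      ENNReal.ofReal (lipConst C α * (lipENorm P 𝓕 α g).toReal) * weightedSum P 𝓕 C α f ω := by
  have h1 : ∀ k, ‖mart P 𝓕 f k ω * mdiff P 𝓕 g k ω‖ₑ ≤
      ∑' j, if j < k then ‖mdiff P 𝓕 f j ω‖ₑ * ‖mdiff P 𝓕 g k ω‖ₑ else 0 := by
    intro k
    rw [enorm_mul, tsum_eq_sum (s := Finset.range k) fun j hj => by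
      rw [if_neg (by simpa using hj)], mart_eq_sum,
      Finset.sum_congr rfl fun j hj => if_pos (Finset.mem_range.1 hj), ← Finset.sum_mul]
    gcongr
    exact enorm_sum_le _ _
  refine (ENNReal.tsum_le_tsum h1).trans ?_
  rw [ENNReal.tsum_comm, weightedSum, ← ENNReal.tsum_mul_left]
  refine ENNReal.tsum_le_tsum fun j => ?_
  have h2 : ∑' k, (if j < k then ‖mdiff P 𝓕 f j ω‖ₑ * ‖mdiff P 𝓕 g k ω‖ₑ else 0) =
      ‖mdiff P 𝓕 f j ω‖ₑ * ∑' i, ‖mdiff P 𝓕 g (j + 1 + i) ω‖ₑ := by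
    rw [← ENNReal.tsum_mul_left, ← ENNReal.summable.sum_add_tsum_nat_add' (k := j + 1)]
    rw [Finset.sum_eq_zero fun k hk => if_neg (by have := Finset.mem_range.1 hk; omega), zero_add]
    refine tsum_congr fun i => ?_
    rw [if_pos (by omega), add_comm i]
  rw [h2, mul_left_comm]
  gcongr
  have := lipConst_nonneg hreg.1 hα
  rw [← ENNReal.ofReal_mul (by positivity)]
  exact tsum_enorm_mdiff_le hreg hatom hα hg hL hω (j + 1)

omit [IsProbabilityMeasure P] in
/-- Summation by parts for the product of two martingales. -/
lemma mart_mul_mart (f g : Ω → 𝕜) (n : ℕ) (ω : Ω) :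
    mart P 𝓕 f n ω * mart P 𝓕 g n ω =
      ∑ k ∈ Finset.range n, (mdiff P 𝓕 f k ω * mdiff P 𝓕 g k ω +
        mart P 𝓕 f k ω * mdiff P 𝓕 g k ω + mdiff P 𝓕 f k ω * mart P 𝓕 g k ω) := by
  induction n with
  | zero => simp [mart]
  | succ n ih =>
    rw [Finset.sum_range_succ, ← ih]
    simp only [mdiff]
    ring

end Bounds

section Identification

variable {Ω : Type*} {m0 : MeasurableSpace Ω} {𝕜 : Type*} [RCLike 𝕜]
  {P : Measure Ω} [IsProbabilityMeasure P] {𝓕 : Filtration ℕ m0}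

/-! ### Identification of martingale differences -/

omit [IsProbabilityMeasure P] in
lemma condExp_mul_left {m : MeasurableSpace Ω} {u v : Ω → 𝕜} (hu : Measurable[m] u)
    (huv : Integrable (fun ω => u ω * v ω) P) (hv : Integrable v P) :
    P[fun ω => u ω * v ω | m] =ᵐ[P] fun ω => u ω * P[v | m] ω :=
  condExp_bilin_of_stronglyMeasurable_left (ContinuousLinearMap.mul ℝ 𝕜)
    (hu.stronglyMeasurable) huv hv

lemma condExp_mdiff (u : Ω → 𝕜) {k : ℕ} (hk : 1 ≤ k) : P[mdiff P 𝓕 u k | 𝓕 k] =ᵐ[P] 0 := by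
  obtain ⟨k, rfl⟩ := Nat.exists_eq_add_of_le' hk
  have h1 : P[mdiff P 𝓕 u (k + 1) | 𝓕 (k + 1)] =ᵐ[P]
      P[P[u | 𝓕 (k + 2)] | 𝓕 (k + 1)] - P[P[u | 𝓕 (k + 1)] | 𝓕 (k + 1)] :=
    condExp_sub integrable_condExp integrable_condExp _
  filter_upwards [h1, condExp_condExp_of_le (μ := P) (f := u) (𝓕.mono (k + 1).le_succ) (𝓕.le _),
    condExp_condExp_of_le (μ := P) (f := u) (le_refl (𝓕 (k + 1))) (𝓕.le _)] with ω h1 h2 h3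
  rw [h1, Pi.sub_apply, h2, h3, sub_self, Pi.zero_apply]

lemma setIntegral_mul_mdiff_eq_zero {u v : Ω → 𝕜} {n k : ℕ} (hn : 1 ≤ n) (hnk : n ≤ k)
    (hu : Measurable[𝓕 k] u) (huv : Integrable (fun ω => u ω * mdiff P 𝓕 v k ω) P)
    {A : Set Ω} (hA : MeasurableSet[𝓕 n] A) : ∫ ω in A, u ω * mdiff P 𝓕 v k ω ∂P = 0 := by
  rw [← setIntegral_condExp (𝓕.le k) huv (𝓕.mono hnk _ hA)]
  refine (setIntegral_congr_ae (g := fun _ => (0 : 𝕜)) (𝓕.le n _ hA) ?_).trans (by simp)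
  filter_upwards [condExp_mul_left hu huv (integrable_mdiff v k),
    condExp_mdiff (P := P) (𝓕 := 𝓕) v (hn.trans hnk)] with ω h1 h2 _
  rw [h1, h2, Pi.zero_apply, mul_zero]

/-- A series of adapted functions `F k` that are orthogonal to the past, and that converges weakly
to `u`, is the series of martingale differences of `u`. -/
lemma ae_mdiff_eq {u : Ω → 𝕜} (hu : Integrable u P) {F : ℕ → Ω → 𝕜}
    (hF : ∀ k, Integrable (F k) P) (hFm : ∀ k, Measurable[𝓕 (k + 1)] (F k))
    (horth : ∀ n k, 1 ≤ n → n ≤ k → ∀ A, MeasurableSet[𝓕 n] A → ∫ ω in A, F k ω ∂P = 0)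
    (hlim : ∀ n, 1 ≤ n → ∀ A, MeasurableSet[𝓕 n] A →
      Filter.Tendsto (fun m => ∑ k ∈ Finset.range m, ∫ ω in A, F k ω ∂P) Filter.atTop
        (nhds (∫ ω in A, u ω ∂P))) :
    ∀ᵐ ω ∂P, ∀ k, mdiff P 𝓕 u k ω = F k ω := by
  have key : ∀ n, mart P 𝓕 u n =ᵐ[P] fun ω => ∑ k ∈ Finset.range n, F k ω := by
    intro n
    cases n with
    | zero => exact Filter.Eventually.of_forall fun ω => by simp [mart]
    | succ n =>
      have hint : Integrable (fun ω => ∑ k ∈ Finset.range (n + 1), F k ω) P :=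
        integrable_finsetSum _ fun k _ => hF k
      refine (ae_eq_condExp_of_forall_setIntegral_eq (𝓕.le (n + 1)) hu
        (fun _ _ _ => hint.integrableOn) (fun A hA _ => ?_) ?_).symm
      · rw [integral_finsetSum _ fun k _ => (hF k).integrableOn]
        refine tendsto_nhds_unique ?_ (hlim (n + 1) (by omega) A hA)
        refine tendsto_const_nhds.congr' ?_
        filter_upwards [Filter.eventually_ge_atTop (n + 1)] with m hm
        refine Finset.sum_subset (Finset.range_subset_range.2 hm) fun k _ hk => ?_
        exact horth (n + 1) k (by omega) (by simpa using hk) A hA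
      · refine (Measurable.stronglyMeasurable ?_).aestronglyMeasurable
        refine Finset.measurable_fun_sum _ fun k hk => (hFm k).mono (𝓕.mono ?_) le_rfl
        have := Finset.mem_range.1 hk
        omega
  filter_upwards [ae_all_iff.2 key] with ω hω k
  rw [mdiff, hω, hω, Finset.sum_range_succ, add_sub_cancel_left]

lemma tendsto_setIntegral_mart_mul_mart {f g : Ω → 𝕜} (hf : Integrable f P) {c : ℝ}
    (hg : ∀ᵐ ω ∂P, ∀ n, ‖mart P 𝓕 g n ω‖ ≤ c)
    (hlim : ∀ᵐ ω ∂P, Filter.Tendsto (fun n => mart P 𝓕 g n ω) Filter.atTop (nhds (g ω)))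
    {n : ℕ} {A : Set Ω} (hA : MeasurableSet[𝓕 n] A) :
    Filter.Tendsto (fun m => ∫ ω in A, mart P 𝓕 f m ω * mart P 𝓕 g m ω ∂P) Filter.atTop
      (nhds (∫ ω in A, f ω * g ω ∂P)) := by
  have h1 : Filter.Tendsto (fun m => ∫ ω in A, f ω * mart P 𝓕 g m ω ∂P) Filter.atTop
      (nhds (∫ ω in A, f ω * g ω ∂P)) := by
    refine tendsto_integral_of_dominated_convergence (fun ω => ‖f ω‖ * c)
      (fun m => (hf.1.mul (measurable_mart g m).aestronglyMeasurable).restrict)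
      (hf.norm.mul_const c).integrableOn (fun m => ae_restrict_of_ae ?_) (ae_restrict_of_ae ?_)
    · filter_upwards [hg] with ω hω
      rw [norm_mul]
      exact mul_le_mul_of_nonneg_left (hω m) (norm_nonneg _)
    · filter_upwards [hlim] with ω hω
      exact hω.const_mul _
  refine h1.congr' ?_
  filter_upwards [Filter.eventually_ge_atTop (max n 1)] with m hm
  obtain ⟨k, rfl⟩ := Nat.exists_eq_add_of_le' ((le_max_right n 1).trans hm)
  have hint : Integrable (fun ω => mart P 𝓕 g (k + 1) ω * f ω) P :=
    hf.bdd_mul (measurable_mart g _).aestronglyMeasurable (hg.mono fun ω hω => hω (k + 1))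
  have hA' := 𝓕.mono ((le_max_left n 1).trans hm) _ hA
  simp only [mul_comm (f _), mul_comm (mart P 𝓕 f _ _)]
  rw [← setIntegral_condExp (𝓕.le (k + 1)) hint hA']
  refine setIntegral_congr_ae (𝓕.le _ _ hA') ?_
  filter_upwards [condExp_mul_left (measurable_mart_filtration g (k + 1)) hint hf] with ω h1 _
  exact h1

end Identification

/-! ### Bilinear maps into `L¹` -/

section Bilinear

variable {Ω : Type*} {m0 : MeasurableSpace Ω} {𝕜 : Type*} [RCLike 𝕜] {P : Measure Ω}
  {X Y : Type*} [AddCommGroup X] [Module 𝕜 X] [AddCommGroup Y] [Module 𝕜 Y]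

/-- A map into functions that is linear up to null sets. -/
structure IsAELinear (P : Measure Ω) (U : X → Ω → 𝕜) : Prop where
  add : ∀ x y, U (x + y) =ᵐ[P] U x + U y
  smul : ∀ (c : 𝕜) x, U (c • x) =ᵐ[P] c • U x

/-- The pointwise product of two a.e. linear maps, as a bilinear map into `L¹`. -/
def mulL1 {U : X → Ω → 𝕜} {V : Y → Ω → 𝕜} (hU : IsAELinear P U) (hV : IsAELinear P V)
    (hint : ∀ x y, Integrable (fun ω => U x ω * V y ω) P) : X →ₗ[𝕜] Y →ₗ[𝕜] Lp 𝕜 1 P :=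
  LinearMap.mk₂ 𝕜 (fun x y => (hint x y).toL1)
    (fun x x' y => by
      rw [← Integrable.toL1_add, Integrable.toL1_eq_toL1_iff]
      filter_upwards [hU.add x x'] with ω h
      simp only [h, Pi.add_apply, add_mul])
    (fun c x y => by
      rw [← Integrable.toL1_smul, Integrable.toL1_eq_toL1_iff]
      filter_upwards [hU.smul c x] with ω h
      simp only [h, Pi.smul_apply, smul_mul_assoc])
    (fun x y y' => by
      rw [← Integrable.toL1_add, Integrable.toL1_eq_toL1_iff]
      filter_upwards [hV.add y y'] with ω h
      simp only [h, Pi.add_apply, mul_add])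
    (fun c x y => by
      rw [← Integrable.toL1_smul, Integrable.toL1_eq_toL1_iff]
      filter_upwards [hV.smul c y] with ω h
      simp only [h, Pi.smul_apply, mul_smul_comm])

lemma coeFn_mulL1 {U : X → Ω → 𝕜} {V : Y → Ω → 𝕜} (hU : IsAELinear P U) (hV : IsAELinear P V)
    (hint : ∀ x y, Integrable (fun ω => U x ω * V y ω) P) (x : X) (y : Y) :
    mulL1 hU hV hint x y =ᵐ[P] fun ω => U x ω * V y ω :=
  (hint x y).coeFn_toL1

/-- Integration against a bounded function, as a continuous functional on `L¹`. -/
def boundedPairing {h : Ω → 𝕜} (hh : MemLp h ∞ P) : Lp 𝕜 1 P →L[𝕜] 𝕜 :=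
  (ContinuousLinearMap.lpPairing P 1 ∞ (ContinuousLinearMap.mul 𝕜 𝕜)).flip hh.toLp

lemma boundedPairing_apply {h : Ω → 𝕜} (hh : MemLp h ∞ P) (u : Lp 𝕜 1 P) :
    boundedPairing hh u = ∫ ω, u ω * h ω ∂P := by
  rw [boundedPairing, ContinuousLinearMap.flip_apply, ContinuousLinearMap.lpPairing_eq_integral]
  refine integral_congr_ae ?_
  filter_upwards [hh.coeFn_toLp] with ω hω
  rw [hω, ContinuousLinearMap.mul_apply']

lemma memLp_indicator_one [IsProbabilityMeasure P] {A : Set Ω} (hA : MeasurableSet A) :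
    MemLp (A.indicator fun _ => (1 : 𝕜)) ∞ P :=
  memLp_indicator_const _ hA _ (Or.inr (measure_ne_top _ _))

lemma boundedPairing_indicator [IsProbabilityMeasure P] {A : Set Ω} (hA : MeasurableSet A)
    (u : Lp 𝕜 1 P) :
    boundedPairing (memLp_indicator_one (𝕜 := 𝕜) hA) u = ∫ ω in A, u ω ∂P := by
  rw [boundedPairing_apply, ← integral_indicator hA]
  congr with ω
  by_cases h : ω ∈ A <;> simp [h]

/-- An absolutely convergent series of products is a bilinear map into `L¹`. -/
lemma exists_tsum_mulL1 [IsProbabilityMeasure P] {U : ℕ → X → Ω → 𝕜} {V : ℕ → Y → Ω → 𝕜}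
    (hU : ∀ k, IsAELinear P (U k)) (hV : ∀ k, IsAELinear P (V k))
    (hint : ∀ k x y, Integrable (fun ω => U k x ω * V k y ω) P)
    (hsum : ∀ x y, ∫⁻ ω, ∑' k, ‖U k x ω * V k y ω‖ₑ ∂P ≠ ∞) :
    ∃ T : X →ₗ[𝕜] Y →ₗ[𝕜] Lp 𝕜 1 P,
      (∀ x y, ‖T x y‖ₑ ≤ ∫⁻ ω, ∑' k, ‖U k x ω * V k y ω‖ₑ ∂P) ∧
      ∀ x y A, MeasurableSet A →
        HasSum (fun k => ∫ ω in A, U k x ω * V k y ω ∂P) (∫ ω in A, T x y ω ∂P) := by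
  set t : ℕ → X →ₗ[𝕜] Y →ₗ[𝕜] Lp 𝕜 1 P := fun k => mulL1 (hU k) (hV k) (hint k) with ht
  have hnorm : ∀ x y, ∑' k, ‖t k x y‖ₑ = ∫⁻ ω, ∑' k, ‖U k x ω * V k y ω‖ₑ ∂P := by
    intro x y
    rw [lintegral_tsum fun k => (hint k x y).1.enorm]
    exact tsum_congr fun k => (hint k x y).enorm_toL1
  have hs : ∀ x y, Summable fun k => t k x y := fun x y =>
    (tsum_enorm_ne_top_iff_summable_norm.1 ((hnorm x y).trans_ne (hsum x y))).of_norm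
  refine ⟨LinearMap.mk₂ 𝕜 (fun x y => ∑' k, t k x y) (fun x x' y => ?_) (fun c x y => ?_)
    (fun x y y' => ?_) (fun c x y => ?_), fun x y => ?_, fun x y A hA => ?_⟩
  · simp only [map_add, LinearMap.add_apply]
    exact (hs x y).tsum_add (hs x' y)
  · simp only [map_smul, LinearMap.smul_apply]
    exact (hs x y).tsum_const_smul c
  · simp only [map_add]
    exact (hs x y).tsum_add (hs x y')
  · simp only [map_smul]
    exact (hs x y).tsum_const_smul c
  · rw [← hnorm]
    exact enorm_tsum_le_tsum_enorm
  · have h := (hs x y).hasSum.mapL (boundedPairing (memLp_indicator_one (𝕜 := 𝕜) hA))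
    rw [boundedPairing_indicator hA] at h
    refine h.congr_fun fun k => ?_
    rw [boundedPairing_indicator hA]
    exact (setIntegral_congr_ae hA ((coeFn_mulL1 (hU k) (hV k) (hint k) x y).mono
      fun ω h _ => h)).symm

end Bilinear

section Paraproducts

variable {Ω : Type*} {m0 : MeasurableSpace Ω} {𝕜 : Type*} [RCLike 𝕜]
  {P : Measure Ω} {𝓕 : Filtration ℕ m0} {p : Set.Ioc (0 : ℝ) 1} {α : ℝ}

/-! ### The paraproducts on the dense subspace -/

lemma HardyL1.integrable (f : HardyL1 𝕜 P 𝓕 p) : Integrable f.toL1 P := L1.integrable_coeFn _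

lemma HardyL1.squareMoment_ne_top (f : HardyL1 𝕜 P 𝓕 p) : squareMoment P 𝓕 p f.toL1 ≠ ∞ :=
  f.moment_ne_top

lemma HardyL1.dist_zero (f : HardyL1 𝕜 P 𝓕 p) : dist f 0 = (squareMoment P 𝓕 p f.toL1).toReal := by
  rw [dist_edist, HardyL1.edist_def, sub_zero]
  rfl

lemma HardyL1.ofReal_dist_zero (f : HardyL1 𝕜 P 𝓕 p) :
    ENNReal.ofReal (dist f 0) = squareMoment P 𝓕 p f.toL1 := by
  rw [HardyL1.dist_zero, ENNReal.ofReal_toReal f.squareMoment_ne_top]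

lemma HardyL1.dist_eq (f g : HardyL1 𝕜 P 𝓕 p) : dist f g = dist (f - g) 0 := by
  rw [dist_edist, dist_edist, HardyL1.edist_def, HardyL1.edist_def, sub_zero]

lemma isAELinear_toL1 :
    IsAELinear P fun (f : HardyL1 𝕜 P 𝓕 p) => (f.toL1 : Ω → 𝕜) where
  add f g := by
    rw [map_add]
    exact Lp.coeFn_add _ _
  smul c f := by
    rw [map_smul]
    exact Lp.coeFn_smul _ _

lemma IsAELinear.mart {X : Type*} [AddCommGroup X] [Module 𝕜 X] {U : X → Ω → 𝕜}
    (hU : IsAELinear P U) (hint : ∀ x, Integrable (U x) P) (k : ℕ) :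
    IsAELinear P fun x => mart P 𝓕 (U x) k where
  add x y := (mart_congr (hU.add x y) k).trans (mart_add (hint x) (hint y) k)
  smul c x := (mart_congr (hU.smul c x) k).trans (mart_smul c k)

lemma IsAELinear.mdiff {X : Type*} [AddCommGroup X] [Module 𝕜 X] {U : X → Ω → 𝕜}
    (hU : IsAELinear P U) (hint : ∀ x, Integrable (U x) P) (k : ℕ) :
    IsAELinear P fun x => mdiff P 𝓕 (U x) k where
  add x y := by
    filter_upwards [(hU.mart (𝓕 := 𝓕) hint (k + 1)).add x y,
      (hU.mart (𝓕 := 𝓕) hint k).add x y] with ω h1 h2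
    simp only [MartHardy.mdiff, h1, h2, Pi.add_apply]
    ring
  smul c x := by
    filter_upwards [(hU.mart (𝓕 := 𝓕) hint (k + 1)).smul c x,
      (hU.mart (𝓕 := 𝓕) hint k).smul c x] with ω h1 h2
    simp only [MartHardy.mdiff, h1, h2, Pi.smul_apply, smul_sub]

/-- A bilinear map into `L¹` with values of finite moment, as a map into the Hardy space. -/
def codRestrictHardy {X Y : Type*} [AddCommGroup X] [Module 𝕜 X] [AddCommGroup Y] [Module 𝕜 Y]
    (T : X →ₗ[𝕜] Y →ₗ[𝕜] Lp 𝕜 1 P) (h : ∀ x y, squareMoment P 𝓕 p (T x y) < ∞) :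
    X →ₗ[𝕜] Y →ₗ[𝕜] HardyL1 𝕜 P 𝓕 p :=
  LinearMap.mk₂ 𝕜 (fun x y => (⟨T x y, h x y⟩ : hardySubmodule 𝕜 P 𝓕 p))
    (fun x x' y => Subtype.ext (by simp only [map_add, LinearMap.add_apply]; rfl))
    (fun c x y => Subtype.ext (by simp only [map_smul, LinearMap.smul_apply]; rfl))
    (fun x y y' => Subtype.ext (by simp only [map_add]; rfl))
    (fun c x y => Subtype.ext (by simp only [map_smul]; rfl))

lemma codRestrictHardy_toL1 {X Y : Type*} [AddCommGroup X] [Module 𝕜 X] [AddCommGroup Y]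
    [Module 𝕜 Y] (T : X →ₗ[𝕜] Y →ₗ[𝕜] Lp 𝕜 1 P) (h : ∀ x y, squareMoment P 𝓕 p (T x y) < ∞)
    (x : X) (y : Y) : (codRestrictHardy T h x y).toL1 = T x y := rfl

/-- The `ℓ²` norm is at most the `ℓ¹` norm. -/
lemma squareFn_le_tsum (u : Ω → 𝕜) (ω : Ω) :
    squareFn P 𝓕 u ω ≤ ∑' k, ‖mdiff P 𝓕 u k ω‖ₑ := by
  have key : ∑' k, ‖mdiff P 𝓕 u k ω‖ₑ ^ (2 : ℝ) ≤ (∑' k, ‖mdiff P 𝓕 u k ω‖ₑ) ^ (2 : ℝ) := by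
    rw [show (2 : ℝ) = 1 + 1 by norm_num]
    simp only [ENNReal.rpow_add_of_nonneg _ _ zero_le_one zero_le_one, ENNReal.rpow_one]
    rw [← ENNReal.tsum_mul_left]
    exact ENNReal.tsum_le_tsum fun k => by gcongr; exact ENNReal.le_tsum k
  have := ENNReal.rpow_le_rpow key (z := 1 / 2) (by norm_num)
  rwa [← ENNReal.rpow_mul, show (2 : ℝ) * (1 / 2) = 1 by norm_num, ENNReal.rpow_one] at this

lemma squareMoment_one_le (u : Ω → 𝕜) :
    squareMoment P 𝓕 1 u ≤ ∫⁻ ω, ∑' k, ‖mdiff P 𝓕 u k ω‖ₑ ∂P := by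
  simp only [squareMoment, ENNReal.rpow_one]
  exact lintegral_mono (squareFn_le_tsum u)

variable [IsProbabilityMeasure P]

lemma isAELinear_toL2 : IsAELinear P fun (g : Lip 𝕜 P 𝓕 α) => (g.toL2 : Ω → 𝕜) where
  add f g := by
    rw [map_add]
    exact Lp.coeFn_add _ _
  smul c f := by
    rw [map_smul]
    exact Lp.coeFn_smul _ _

lemma Lip.lipENorm_ne_top (g : Lip 𝕜 P 𝓕 α) : lipENorm P 𝓕 α g.toL2 ≠ ∞ := (Subtype.prop g).ne

/-- The bilinear series of the products `U k f * (g_{k+1} - g_k)` under a bound by `weightedSum`. -/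
lemma exists_paraproduct {C : ℝ} (hreg : RegularWith P 𝓕 C)
    (hatom : ∀ k, CountablyAtomic (𝓕 k)) (hα : α = 1 / (p : ℝ) - 1) (hα0 : 0 < α)
    {U : ℕ → HardyL1 𝕜 P 𝓕 p → Ω → 𝕜} (hU : ∀ k, IsAELinear P (U k))
    (hint : ∀ k f (g : Lip 𝕜 P 𝓕 α), Integrable (fun ω => U k f ω * mdiff P 𝓕 g.toL2 k ω) P)
    (hbound : ∀ f (g : Lip 𝕜 P 𝓕 α), ∀ᵐ ω ∂P, ∑' k, ‖U k f ω * mdiff P 𝓕 g.toL2 k ω‖ₑ ≤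
      ENNReal.ofReal (lipConst C α * ‖g‖) * weightedSum P 𝓕 C α f.toL1 ω) :
    ∃ T : HardyL1 𝕜 P 𝓕 p →ₗ[𝕜] Lip 𝕜 P 𝓕 α →ₗ[𝕜] Lp 𝕜 1 P,
      (∀ f (g : Lip 𝕜 P 𝓕 α), ∫⁻ ω, ∑' k, ‖U k f ω * mdiff P 𝓕 g.toL2 k ω‖ₑ ∂P ≤
        ENNReal.ofReal (lipConst C α * hardyConst C α * ‖g‖ * dist f 0 ^ (1 / (p : ℝ)))) ∧
      (∀ f g, ‖T f g‖ ≤ lipConst C α * hardyConst C α * ‖g‖ * dist f 0 ^ (1 / (p : ℝ))) ∧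
      ∀ f (g : Lip 𝕜 P 𝓕 α) A, MeasurableSet A →
        HasSum (fun k => ∫ ω in A, U k f ω * mdiff P 𝓕 g.toL2 k ω ∂P) (∫ ω in A, T f g ω ∂P) := by
  have hl := lipConst_nonneg hreg.1 hα0
  have hh := hardyConst_nonneg hreg.1 hα0
  have hle : ∀ f (g : Lip 𝕜 P 𝓕 α), ∫⁻ ω, ∑' k, ‖U k f ω * mdiff P 𝓕 g.toL2 k ω‖ₑ ∂P ≤
      ENNReal.ofReal (lipConst C α * hardyConst C α * ‖g‖ * dist f 0 ^ (1 / (p : ℝ))) := by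
    intro f g
    calc ∫⁻ ω, ∑' k, ‖U k f ω * mdiff P 𝓕 g.toL2 k ω‖ₑ ∂P
        ≤ ∫⁻ ω, ENNReal.ofReal (lipConst C α * ‖g‖) * weightedSum P 𝓕 C α f.toL1 ω ∂P :=
          lintegral_mono_ae (hbound f g)
      _ ≤ ENNReal.ofReal (lipConst C α * ‖g‖) * (ENNReal.ofReal (hardyConst C α) *
            ENNReal.ofReal (dist f 0) ^ (1 / (p : ℝ))) := by
          rw [lintegral_const_mul' _ _ ENNReal.ofReal_ne_top, f.ofReal_dist_zero]
          gcongr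
          exact lintegral_weightedSum_le hreg hatom p.2.1 hα hα0 f.integrable f.squareMoment_ne_top
      _ = _ := by
          rw [ENNReal.ofReal_rpow_of_nonneg dist_nonneg (one_div_pos.2 p.2.1).le,
            ← ENNReal.ofReal_mul hh, ← ENNReal.ofReal_mul (by positivity)]
          congr 1
          ring
  obtain ⟨T, hT1, hT2⟩ := exists_tsum_mulL1 hU
    (fun k => isAELinear_toL2.mdiff (fun g => integrable_L2 g.toL2) k) hint
    (fun f g => ((hle f g).trans_lt ENNReal.ofReal_lt_top).ne)
  refine ⟨T, hle, fun f g => ?_, hT2⟩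
  rw [← toReal_enorm]
  refine ENNReal.toReal_le_of_le_ofReal ?_ ((hT1 f g).trans (hle f g))
  positivity

/-- The decomposition `f g = Π₁ + Π₂ + Π₃` on the dense subspace of the Hardy space. The
third part is *defined* as the remainder `f g - Π₁ - Π₂`, which is integrable since `g` is bounded;
its martingale differences are then found to be `(f_{k+1} - f_k) g_k`. -/
theorem exists_decomposition (hgen : ⨆ k, 𝓕 k = m0) (hreg : IsRegular P 𝓕)
    (hatom : ∀ k, CountablyAtomic (𝓕 k)) (hα : α = 1 / (p : ℝ) - 1) (hα0 : 0 < α) :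
    ∃ K : ℝ, 0 ≤ K ∧ ∃ (T T₁ T₂ : HardyL1 𝕜 P 𝓕 p →ₗ[𝕜] Lip 𝕜 P 𝓕 α →ₗ[𝕜] Lp 𝕜 1 P)
      (T₃ : HardyL1 𝕜 P 𝓕 p →ₗ[𝕜] Lip 𝕜 P 𝓕 α →ₗ[𝕜] HardyL1 𝕜 P 𝓕 p),
      (∀ g : Lip 𝕜 P 𝓕 α, ∀ᵐ ω ∂P, ‖g.toL2 ω‖ ≤ K * ‖g‖) ∧
      (∀ f (g : Lip 𝕜 P 𝓕 α), ∀ᵐ ω ∂P, T f g ω = f.toL1 ω * g.toL2 ω) ∧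
      (∀ f g, T f g = T₁ f g + T₂ f g + (T₃ f g).toL1) ∧
      (∀ f g, ∫ ω, T f g ω ∂P = ∫ ω, T₁ f g ω ∂P) ∧
      (∀ f g, ‖T₁ f g‖ ≤ K * ‖g‖ * dist f 0 ^ (1 / (p : ℝ))) ∧
      (∀ f g, ‖T₂ f g‖ ≤ K * ‖g‖ * dist f 0 ^ (1 / (p : ℝ))) ∧
      (∀ f g, ∫⁻ ω, ∑' k, ‖mdiff P 𝓕 (T₂ f g) k ω‖ₑ ∂P ≤
        ENNReal.ofReal (K * ‖g‖ * dist f 0 ^ (1 / (p : ℝ)))) ∧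
      (∀ f g, dist (T₃ f g) 0 ≤ (K * ‖g‖) ^ (p : ℝ) * dist f 0) := by
  obtain ⟨C, hreg⟩ := hreg.exists_regularWith
  have hl := lipConst_nonneg hreg.1 hα0
  have hh := hardyConst_nonneg hreg.1 hα0
  have hs := supConst_nonneg hreg.1 hα0
  have hgint : ∀ g : Lip 𝕜 P 𝓕 α, Integrable g.toL2 P := fun g => integrable_L2 g.toL2
  have hmart : ∀ g : Lip 𝕜 P 𝓕 α, ∀ᵐ ω ∂P, ∀ n, ‖mart P 𝓕 g.toL2 n ω‖ ≤ supConst C α * ‖g‖ :=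
    fun g => (ae_measure_atomOf_ne_zero hatom).mono fun ω hω n =>
      norm_mart_le hreg hatom hα0 (hgint g) g.lipENorm_ne_top hω n
  have hbdd : ∀ g : Lip 𝕜 P 𝓕 α, ∀ᵐ ω ∂P, ‖g.toL2 ω‖ ≤ supConst C α * ‖g‖ := fun g =>
    ae_norm_le_of_lip hreg hatom hgen hα0 (hgint g) g.lipENorm_ne_top
  have hmul_mart : ∀ (u : Ω → 𝕜) (g : Lip 𝕜 P 𝓕 α) k, Integrable u P →
      Integrable (fun ω => u ω * mart P 𝓕 g.toL2 k ω) P := fun u g k hu =>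
    hu.mul_bdd (measurable_mart _ k).aestronglyMeasurable ((hmart g).mono fun ω hω => hω k)
  have hmul_mdiff : ∀ (u : Ω → 𝕜) (g : Lip 𝕜 P 𝓕 α) k, Integrable u P →
      Integrable (fun ω => u ω * mdiff P 𝓕 g.toL2 k ω) P := fun u g k hu => by
    simp only [mdiff, mul_sub]
    exact (hmul_mart u g (k + 1) hu).sub (hmul_mart u g k hu)
  have hmul_g : ∀ (f : HardyL1 𝕜 P 𝓕 p) (g : Lip 𝕜 P 𝓕 α),
      Integrable (fun ω => f.toL1 ω * g.toL2 ω) P := fun f g =>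
    f.integrable.mul_bdd (hgint g).1 (hbdd g)
  obtain ⟨T₁, -, hT₁, hsum₁⟩ := exists_paraproduct hreg hatom hα hα0
    (U := fun k (f : HardyL1 𝕜 P 𝓕 p) => mdiff P 𝓕 f.toL1 k)
    (fun k => isAELinear_toL1.mdiff HardyL1.integrable k)
    (fun k f g => hmul_mdiff _ g k (integrable_mdiff _ k))
    (fun f g => (ae_measure_atomOf_ne_zero hatom).mono fun ω hω =>
      tsum_enorm_mdiff_mul_mdiff_le hreg hatom hα0 _ (hgint g) g.lipENorm_ne_top hω)
  obtain ⟨T₂, hS₂, hT₂, hsum₂⟩ := exists_paraproduct hreg hatom hα hα0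
    (U := fun k (f : HardyL1 𝕜 P 𝓕 p) => mart P 𝓕 f.toL1 k)
    (fun k => isAELinear_toL1.mart HardyL1.integrable k)
    (fun k f g => hmul_mdiff _ g k (integrable_mart _ k))
    (fun f g => (ae_measure_atomOf_ne_zero hatom).mono fun ω hω =>
      tsum_enorm_mart_mul_mdiff_le hreg hatom hα0 _ (hgint g) g.lipENorm_ne_top hω)
  set T := mulL1 (isAELinear_toL1 (𝕜 := 𝕜) (P := P) (𝓕 := 𝓕) (p := p))
    (isAELinear_toL2 (α := α)) hmul_g with hTdef
  have hT : ∀ f (g : Lip 𝕜 P 𝓕 α), ∀ᵐ ω ∂P, T f g ω = f.toL1 ω * g.toL2 ω :=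
    fun f g => coeFn_mulL1 _ _ _ f g
  -- the martingale differences of the second part
  have hd₂ : ∀ f g, ∀ᵐ ω ∂P, ∀ k, mdiff P 𝓕 (T₂ f g) k ω =
      mart P 𝓕 f.toL1 k ω * mdiff P 𝓕 g.toL2 k ω := fun f g =>
    ae_mdiff_eq (L1.integrable_coeFn _) (fun k => hmul_mdiff _ g k (integrable_mart _ k))
      (fun k => ((measurable_mart_filtration _ k).mono (𝓕.mono k.le_succ) le_rfl).mul
        (measurable_mdiff_filtration _ k))
      (fun n k hn hnk A hA => setIntegral_mul_mdiff_eq_zero hn hnk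
        (measurable_mart_filtration _ k) (hmul_mdiff _ g k (integrable_mart _ k)) hA)
      (fun n hn A hA => (hsum₂ f g A (𝓕.le n _ hA)).tendsto_sum_nat)
  -- the martingale differences of the third part
  have hd₃ : ∀ f g, ∀ᵐ ω ∂P, ∀ k, mdiff P 𝓕 ((T - T₁ - T₂) f g) k ω =
      mart P 𝓕 g.toL2 k ω * mdiff P 𝓕 f.toL1 k ω := by
    intro f g
    have hint : ∀ k, Integrable (fun ω => mart P 𝓕 g.toL2 k ω * mdiff P 𝓕 f.toL1 k ω) P :=
      fun k => by simpa only [mul_comm] using hmul_mart _ g k (integrable_mdiff f.toL1 k)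
    refine ae_mdiff_eq (L1.integrable_coeFn _) hint
      (fun k => ((measurable_mart_filtration _ k).mono (𝓕.mono k.le_succ) le_rfl).mul
        (measurable_mdiff_filtration _ k))
      (fun n k hn hnk A hA => setIntegral_mul_mdiff_eq_zero hn hnk
        (measurable_mart_filtration _ k) (hint k) hA)
      (fun n hn A hA => ?_)
    have hA' := 𝓕.le n _ hA
    have h0 := tendsto_setIntegral_mart_mul_mart f.integrable (hmart g)
      (ae_tendsto_mart hgen (hgint g)) hA
    have h := (h0.sub (hsum₁ f g A hA').tendsto_sum_nat).sub (hsum₂ f g A hA').tendsto_sum_nat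
    have hval : ∫ ω in A, (T - T₁ - T₂) f g ω ∂P = ∫ ω in A, f.toL1 ω * g.toL2 ω ∂P -
        ∫ ω in A, T₁ f g ω ∂P - ∫ ω in A, T₂ f g ω ∂P := by
      rw [← setIntegral_congr_ae hA' ((hT f g).mono fun ω h _ => h)]
      simp only [← boundedPairing_indicator hA', LinearMap.sub_apply, map_sub]
    rw [hval]
    refine h.congr fun m => ?_
    simp only [mart_mul_mart]
    rw [integral_finsetSum, ← Finset.sum_sub_distrib, ← Finset.sum_sub_distrib]
    · refine Finset.sum_congr rfl fun k _ => ?_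
      have i1 := (hmul_mdiff _ g k (integrable_mdiff (𝓕 := 𝓕) f.toL1 k)).integrableOn (s := A)
      have i2 := (hmul_mdiff _ g k (integrable_mart (𝓕 := 𝓕) f.toL1 k)).integrableOn (s := A)
      have i3 := (hmul_mart _ g k (integrable_mdiff (𝓕 := 𝓕) f.toL1 k)).integrableOn (s := A)
      rw [integral_add (i1.fun_add i2) i3, integral_add i1 i2]
      simp only [mul_comm (mart P 𝓕 g.toL2 k _)]
      ring
    · intro k _
      exact ((hmul_mdiff _ g k (integrable_mdiff (𝓕 := 𝓕) f.toL1 k)).add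
        (hmul_mdiff _ g k (integrable_mart (𝓕 := 𝓕) f.toL1 k))).add
          (hmul_mart _ g k (integrable_mdiff (𝓕 := 𝓕) f.toL1 k)) |>.integrableOn
  have hmoment₃ : ∀ f g, squareMoment P 𝓕 p ((T - T₁ - T₂) f g) ≤
      ENNReal.ofReal (supConst C α * ‖g‖) ^ (p : ℝ) * squareMoment P 𝓕 p f.toL1 := by
    intro f g
    have hp := p.2.1.le
    unfold squareMoment
    rw [← lintegral_const_mul' _ _ (ENNReal.rpow_ne_top_of_nonneg hp ENNReal.ofReal_ne_top)]
    refine lintegral_mono_ae ?_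
    filter_upwards [hd₃ f g, hmart g] with ω h1 h2
    rw [← ENNReal.mul_rpow_of_nonneg _ _ hp]
    refine ENNReal.rpow_le_rpow ?_ hp
    have h3 : ∑' k, ‖mdiff P 𝓕 ((T - T₁ - T₂) f g) k ω‖ₑ ^ (2 : ℝ) ≤
        ENNReal.ofReal (supConst C α * ‖g‖) ^ (2 : ℝ) *
          ∑' k, ‖mdiff P 𝓕 f.toL1 k ω‖ₑ ^ (2 : ℝ) := by
      rw [← ENNReal.tsum_mul_left]
      refine ENNReal.tsum_le_tsum fun k => ?_
      rw [← ENNReal.mul_rpow_of_nonneg _ _ (by norm_num), h1, enorm_mul]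
      gcongr
      rw [← ofReal_norm]
      exact ENNReal.ofReal_le_ofReal (h2 k)
    have h4 := ENNReal.rpow_le_rpow h3 (z := 1 / 2) (by norm_num)
    rwa [ENNReal.mul_rpow_of_nonneg _ _ (by norm_num), ← ENNReal.rpow_mul,
      show (2 : ℝ) * (1 / 2) = 1 by norm_num, ENNReal.rpow_one] at h4
  have hfin₃ : ∀ f g, squareMoment P 𝓕 p ((T - T₁ - T₂) f g) < ∞ := fun f g =>
    (hmoment₃ f g).trans_lt <| ENNReal.mul_lt_top
      (ENNReal.rpow_lt_top_of_nonneg p.2.1.le ENNReal.ofReal_ne_top) f.squareMoment_ne_top.lt_top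
  have hzero : ∀ u : Lp 𝕜 1 P, (∀ᵐ ω ∂P, mdiff P 𝓕 u 0 ω = 0) → ∫ ω, u ω ∂P = 0 := by
    intro u hu
    rw [← integral_condExp (𝓕.le 1)]
    refine integral_eq_zero_of_ae (hu.mono fun ω h => ?_)
    simpa [mdiff, mart] using h
  set K := lipConst C α * hardyConst C α + supConst C α with hK
  have hK1 : lipConst C α * hardyConst C α ≤ K := by linarith
  have hK2 : supConst C α ≤ K := by nlinarith
  have hK1' : ∀ (f : HardyL1 𝕜 P 𝓕 p) (g : Lip 𝕜 P 𝓕 α),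
      lipConst C α * hardyConst C α * ‖g‖ * dist f 0 ^ (1 / (p : ℝ)) ≤
        K * ‖g‖ * dist f 0 ^ (1 / (p : ℝ)) := fun f g => by gcongr
  refine ⟨K, by positivity, T, T₁, T₂, codRestrictHardy (T - T₁ - T₂) hfin₃,
    fun g => (hbdd g).mono fun ω h => h.trans (by gcongr), hT, fun f g => ?_, fun f g => ?_,
    fun f g => (hT₁ f g).trans (hK1' f g), fun f g => (hT₂ f g).trans (hK1' f g),
    fun f g => ?_, fun f g => ?_⟩
  · rw [codRestrictHardy_toL1]
    simp only [LinearMap.sub_apply]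
    abel
  · have h2 := hzero (T₂ f g) ((hd₂ f g).mono fun ω h => by rw [h]; simp [mart])
    have h3 := hzero ((T - T₁ - T₂) f g) ((hd₃ f g).mono fun ω h => by rw [h]; simp [mart])
    have h4 : T f g = T₁ f g + T₂ f g + (T - T₁ - T₂) f g := by
      simp only [LinearMap.sub_apply]
      abel
    have hlin : ∀ u v : Lp 𝕜 1 P, ∫ ω, (u + v : Lp 𝕜 1 P) ω ∂P = ∫ ω, u ω ∂P + ∫ ω, v ω ∂P :=
      fun u v => by
        rw [← integral_add (L1.integrable_coeFn u) (L1.integrable_coeFn v)]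
        exact integral_congr_ae (Lp.coeFn_add u v)
    rw [h4, hlin, hlin, h2, h3, add_zero, add_zero]
  · refine le_trans ?_ ((hS₂ f g).trans (ENNReal.ofReal_le_ofReal (hK1' f g)))
    refine lintegral_mono_ae ((hd₂ f g).mono fun ω h => ?_)
    simp only [h, le_refl]
  · rw [HardyL1.dist_zero, f.dist_zero, codRestrictHardy_toL1]
    have h := ENNReal.toReal_mono (ENNReal.mul_ne_top (ENNReal.rpow_ne_top_of_nonneg p.2.1.le
      ENNReal.ofReal_ne_top) f.squareMoment_ne_top) (hmoment₃ f g)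
    have hg : 0 ≤ supConst C α * ‖g‖ := by positivity
    rw [ENNReal.toReal_mul, ← ENNReal.toReal_rpow, ENNReal.toReal_ofReal hg] at h
    refine h.trans ?_
    have := p.2.1.le
    gcongr

end Paraproducts

/-! ### Extension of bilinear maps to a completion -/

section Extension

open UniformSpace Topology

variable {𝕜 X Y E : Type*} [RCLike 𝕜] [AddCommGroup X] [Module 𝕜 X] [PseudoMetricSpace X]
  [SeminormedAddCommGroup Y] [Module 𝕜 Y] [AddCommGroup E] [Module 𝕜 E]

/-- Joint continuity of a bilinear map from a bound in terms of translation invariant metrics. -/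
lemma continuous_of_bilinear_bound [PseudoMetricSpace E]
    (hX : ∀ x x' : X, dist x x' = dist (x - x') 0) (hE : ∀ u v : E, dist u v = dist (u - v) 0)
    {c : Y → ℝ} (hc : Continuous c) (hc0 : c 0 = 0) {a : ℝ} (ha : 0 < a) (T : X →ₗ[𝕜] Y →ₗ[𝕜] E)
    (hT : ∀ x y, dist (T x y) 0 ≤ c y * dist x 0 ^ a) :
    Continuous fun z : X × Y => T z.1 z.2 := by
  rw [continuous_iff_continuousAt]
  rintro ⟨x₀, y₀⟩
  rw [ContinuousAt, tendsto_iff_dist_tendsto_zero]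
  have h1 : Filter.Tendsto (fun z : X × Y => c z.2 * dist z.1 x₀ ^ a +
      c (z.2 - y₀) * dist x₀ 0 ^ a) (𝓝 (x₀, y₀)) (𝓝 (c y₀ * dist x₀ x₀ ^ a +
      c (y₀ - y₀) * dist x₀ 0 ^ a)) := by
    refine Continuous.tendsto (f := fun z : X × Y => c z.2 * dist z.1 x₀ ^ a +
      c (z.2 - y₀) * dist x₀ 0 ^ a) ?_ (x₀, y₀)
    refine ((hc.comp continuous_snd).mul ?_).add
      ((hc.comp (continuous_snd.sub continuous_const)).mul continuous_const)
    exact (continuous_fst.dist continuous_const).rpow_const fun _ => Or.inr ha.le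
  rw [dist_self, sub_self, hc0, Real.zero_rpow ha.ne', mul_zero, zero_mul, add_zero] at h1
  refine squeeze_zero (fun _ => dist_nonneg) (fun z => ?_) h1
  refine (dist_triangle _ (T x₀ z.2) _).trans (add_le_add ?_ ?_)
  · rw [hE, ← LinearMap.sub_apply, ← map_sub, hX z.1]
    exact hT _ _
  · rw [hE, ← map_sub]
    exact hT _ _

variable [IsUniformAddGroup X] [UniformContinuousConstSMul 𝕜 X]

/-- A bounded bilinear map extends to the completion in its first argument, with the same bound. -/
lemma exists_bilinear_extension [MetricSpace E] [IsUniformAddGroup E] [ContinuousConstSMul 𝕜 E]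
    [CompleteSpace E] {c : Y → ℝ} {a : ℝ} (ha : 0 < a) (T : X →ₗ[𝕜] Y →ₗ[𝕜] E)
    (hT : ∀ x y, dist (T x y) 0 ≤ c y * dist x 0 ^ a) :
    ∃ T' : Completion X →ₗ[𝕜] Y →ₗ[𝕜] E, (∀ (x : X) y, T' (x : Completion X) y = T x y) ∧
      (∀ y, Continuous fun x => T' x y) ∧ ∀ x y, dist (T' x y) 0 ≤ c y * dist x 0 ^ a := by
  have hcont : ∀ y, Continuous (T.flip y) := by
    intro y
    refine continuous_of_continuousAt_zero (T.flip y) ?_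
    rw [ContinuousAt, map_zero, tendsto_iff_dist_tendsto_zero]
    have h1 : Filter.Tendsto (fun x : X => c y * dist x 0 ^ a) (𝓝 0)
        (𝓝 (c y * dist (0 : X) 0 ^ a)) := by
      refine Continuous.tendsto (f := fun x : X => c y * dist x 0 ^ a) ?_ 0
      exact continuous_const.mul
        ((continuous_id.dist continuous_const).rpow_const fun _ => Or.inr ha.le)
    rw [dist_self, Real.zero_rpow ha.ne', mul_zero] at h1
    exact squeeze_zero (fun _ => dist_nonneg) (fun x => hT x y) h1
  let e : X →L[𝕜] Completion X :=
    { toFun := (↑)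
      map_add' := Completion.coe_add
      map_smul' := fun c x => Completion.coe_smul c x
      cont := Completion.continuous_coe X }
  let L : Y → Completion X →L[𝕜] E := fun y =>
    ContinuousLinearMap.extend (⟨T.flip y, hcont y⟩ : X →L[𝕜] E) e
  have hL : ∀ y (x : X), L y (x : Completion X) = T x y := fun y x =>
    ContinuousLinearMap.extend_eq (⟨T.flip y, hcont y⟩ : X →L[𝕜] E) (e := e)
      Completion.denseRange_coe (Completion.isUniformInducing_coe X) x
  refine ⟨LinearMap.mk₂ 𝕜 (fun x y => L y x) (fun x x' y => map_add _ _ _)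
    (fun c x y => map_smul _ _ _) (fun x y y' => ?_) (fun c x y => ?_), fun x y => hL y x,
    fun y => (L y).continuous, fun x y => ?_⟩
  · refine Completion.induction_on x
      (isClosed_eq (L _).continuous ((L y).continuous.add (L y').continuous)) fun x => ?_
    rw [hL, hL, hL, map_add]
  · refine Completion.induction_on x
      (isClosed_eq (L _).continuous ((L y).continuous.const_smul c)) fun x => ?_
    rw [hL, hL, map_smul]
  · refine Completion.induction_on x (isClosed_le ((L y).continuous.dist continuous_const) ?_)
      fun x => ?_
    · exact continuous_const.mul
        ((continuous_id.dist continuous_const).rpow_const fun _ => Or.inr ha.le)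
    · rw [LinearMap.mk₂_apply, hL, ← Completion.coe_zero, Completion.dist_eq]
      exact hT x y

/-- The case of `exists_bilinear_extension` where the values lie in the space itself. -/
lemma exists_bilinear_extension_self (T : X →ₗ[𝕜] Y →ₗ[𝕜] X) {c : Y → ℝ}
    (hT : ∀ x y, dist (T x y) 0 ≤ c y * dist x 0) :
    ∃ T' : Completion X →ₗ[𝕜] Y →ₗ[𝕜] Completion X,
      (∀ (x : X) y, T' (x : Completion X) y = (T x y : Completion X)) ∧
      (∀ y, Continuous fun x => T' x y) ∧ ∀ x y, dist (T' x y) 0 ≤ c y * dist x 0 ^ (1 : ℝ) :=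
  exists_bilinear_extension one_pos
    (LinearMap.mk₂ 𝕜 (fun x y => (T x y : Completion X))
      (fun x x' y => by rw [map_add, LinearMap.add_apply, Completion.coe_add])
      (fun c x y => by rw [map_smul, LinearMap.smul_apply, Completion.coe_smul])
      (fun x y y' => by rw [map_add, Completion.coe_add])
      (fun c x y => by rw [map_smul, Completion.coe_smul]))
    (fun x y => by
      rw [LinearMap.mk₂_apply, ← Completion.coe_zero, Completion.dist_eq, Real.rpow_one]
      exact hT x y)

omit [UniformContinuousConstSMul 𝕜 X] [Module 𝕜 X] in
lemma completion_dist_eq (hX : ∀ x x' : X, dist x x' = dist (x - x') 0) (x x' : Completion X) :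
    dist x x' = dist (x - x') 0 := by
  refine Completion.induction_on₂ x x' (isClosed_eq continuous_dist
    ((continuous_fst.sub continuous_snd).dist continuous_const)) fun x x' => ?_
  rw [← Completion.coe_sub, ← Completion.coe_zero, Completion.dist_eq, Completion.dist_eq]
  exact hX x x'

end Extension

section Product

variable {Ω : Type*} {m0 : MeasurableSpace Ω} {𝕜 : Type*} [RCLike 𝕜]
  {P : Measure Ω} [IsProbabilityMeasure P] {𝓕 : Filtration ℕ m0} {α : ℝ}

/-! ### Lower semicontinuity of the variation of a martingale -/

lemma exists_condExp_clm (n : ℕ) :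
    ∃ D : Lp 𝕜 1 P →L[ℝ] Lp 𝕜 1 P, ∀ u : Lp 𝕜 1 P, D u =ᵐ[P] mart P 𝓕 u n := by
  cases n with
  | zero => exact ⟨0, fun u => Lp.coeFn_zero _ _ _⟩
  | succ n =>
    refine ⟨condExpL1CLM 𝕜 (𝓕.le (n + 1)) P, fun u => ?_⟩
    have h := condExp_ae_eq_condExpL1CLM (𝓕.le (n + 1)) (L1.integrable_coeFn u)
    rw [Integrable.toL1_coeFn] at h
    exact h.symm

lemma lowerSemicontinuous_lintegral_tsum_mdiff :
    LowerSemicontinuous fun u : Lp 𝕜 1 P => ∫⁻ ω, ∑' k, ‖mdiff P 𝓕 u k ω‖ₑ ∂P := by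
  choose D hD using exists_condExp_clm (𝕜 := 𝕜) (P := P) (𝓕 := 𝓕)
  have h : ∀ u : Lp 𝕜 1 P, ∫⁻ ω, ∑' k, ‖mdiff P 𝓕 u k ω‖ₑ ∂P =
      ∑' k, ‖(D (k + 1) - D k) u‖ₑ := by
    intro u
    rw [lintegral_tsum fun k => (measurable_mdiff (P := P) (𝓕 := 𝓕) u k).enorm.aemeasurable]
    refine tsum_congr fun k => ?_
    rw [Lp.enorm_def, eLpNorm_one_eq_lintegral_enorm, sub_apply]
    refine lintegral_congr_ae ?_
    filter_upwards [hD (k + 1) u, hD k u, Lp.coeFn_sub (D (k + 1) u) (D k u)] with ω h1 h2 h3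
    rw [h3, Pi.sub_apply, h1, h2, mdiff]
  simp only [h]
  exact lowerSemicontinuous_tsum fun k =>
    ((D (k + 1) - D k).continuous.enorm).lowerSemicontinuous

/-! ### Products of Lipschitz functions -/

lemma setLIntegral_sub_condExp_le {n : ℕ} {u h g : Ω → 𝕜} (hu : Integrable u P)
    (hhg : Integrable (fun ω => mart P 𝓕 h n ω * mart P 𝓕 g n ω) P) {A : Set Ω}
    (hA : MeasurableSet[𝓕 n] A) :
    ∫⁻ ω in A, ‖u ω - mart P 𝓕 u n ω‖ₑ ∂P ≤
      2 * ∫⁻ ω in A, ‖u ω - mart P 𝓕 h n ω * mart P 𝓕 g n ω‖ₑ ∂P := by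
  cases n with
  | zero =>
    simp only [mart, Pi.zero_apply, mul_zero, sub_zero]
    exact le_mul_of_one_le_left' one_le_two
  | succ n =>
    set v : Ω → 𝕜 := fun ω => mart P 𝓕 h (n + 1) ω * mart P 𝓕 g (n + 1) ω with hv
    have hvm : StronglyMeasurable[𝓕 (n + 1)] v :=
      ((measurable_mart_filtration h _).mul (measurable_mart_filtration g _)).stronglyMeasurable
    have huv : Integrable (u - v) P := hu.sub hhg
    have h1 : P[u - v | 𝓕 (n + 1)] =ᵐ[P] P[u | 𝓕 (n + 1)] - v := by
      have := condExp_sub hu hhg (𝓕 (n + 1))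
      rwa [condExp_of_stronglyMeasurable (𝓕.le _) hvm hhg] at this
    have h2 : ∫⁻ ω in A, ‖P[u - v | 𝓕 (n + 1)] ω‖ₑ ∂P ≤ ∫⁻ ω in A, ‖(u - v) ω‖ₑ ∂P := by
      rw [← ofReal_integral_norm_eq_lintegral_enorm integrable_condExp.integrableOn,
        ← ofReal_integral_norm_eq_lintegral_enorm huv.integrableOn]
      exact ENNReal.ofReal_le_ofReal (setIntegral_norm_condExp_le hA _)
    calc ∫⁻ ω in A, ‖u ω - mart P 𝓕 u (n + 1) ω‖ₑ ∂P
        ≤ ∫⁻ ω in A, (‖(u - v) ω‖ₑ + ‖P[u - v | 𝓕 (n + 1)] ω‖ₑ) ∂P := by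
          refine lintegral_mono_ae (ae_restrict_of_ae ?_)
          filter_upwards [h1] with ω h1
          have h3 : u ω - mart P 𝓕 u (n + 1) ω = (u - v) ω - P[u - v | 𝓕 (n + 1)] ω := by
            rw [h1, Pi.sub_apply, Pi.sub_apply, mart]
            ring
          rw [h3]
          exact enorm_sub_le
      _ ≤ _ := by
          rw [lintegral_add_left' huv.1.enorm.restrict, two_mul]
          exact add_le_add le_rfl h2

lemma lipENorm_mul_le {g h : Ω → 𝕜} {a b : ℝ} (hgi : Integrable g P) (hhi : Integrable h P)
    (hg : ∀ᵐ ω ∂P, ‖g ω‖ ≤ a) (hh : ∀ᵐ ω ∂P, ‖h ω‖ ≤ b) :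
    lipENorm P 𝓕 α (fun ω => h ω * g ω) ≤ 2 * (ENNReal.ofReal b * lipENorm P 𝓕 α g +
      ENNReal.ofReal a * lipENorm P 𝓕 α h) := by
  have ha : 0 ≤ a := let ⟨ω, hω⟩ := hg.exists; (norm_nonneg _).trans hω
  refine iSup_le fun n => iSup_le fun A => iSup_le fun hA => ?_
  have hle : ∀ u : Ω → 𝕜, P A ^ (-1 - α) * ∫⁻ ω in A, ‖u ω - mart P 𝓕 u n ω‖ₑ ∂P
      ≤ lipENorm P 𝓕 α u := fun u =>
    le_iSup_of_le n (le_iSup_of_le A (le_iSup_of_le hA le_rfl))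
  have hgn : ∀ᵐ ω ∂P, ‖mart P 𝓕 g n ω‖ ≤ a := by
    cases n with
    | zero => exact Filter.Eventually.of_forall fun ω => by simpa [mart] using ha
    | succ n => exact ae_bdd_norm_condExp_of_ae_bdd_norm hg
  have hint : Integrable (fun ω => mart P 𝓕 h n ω * mart P 𝓕 g n ω) P :=
    (integrable_mart h n).mul_bdd (measurable_mart g n).aestronglyMeasurable hgn
  have key : ∫⁻ ω in A, ‖h ω * g ω - mart P 𝓕 h n ω * mart P 𝓕 g n ω‖ₑ ∂P ≤
      ENNReal.ofReal b * ∫⁻ ω in A, ‖g ω - mart P 𝓕 g n ω‖ₑ ∂P +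
        ENNReal.ofReal a * ∫⁻ ω in A, ‖h ω - mart P 𝓕 h n ω‖ₑ ∂P := by
    rw [← lintegral_const_mul' _ _ ENNReal.ofReal_ne_top,
      ← lintegral_const_mul' _ _ ENNReal.ofReal_ne_top, ← lintegral_add_left']
    · refine lintegral_mono_ae (ae_restrict_of_ae ?_)
      filter_upwards [hgn, hh] with ω h1 h2
      have h3 : h ω * g ω - mart P 𝓕 h n ω * mart P 𝓕 g n ω =
          h ω * (g ω - mart P 𝓕 g n ω) + mart P 𝓕 g n ω * (h ω - mart P 𝓕 h n ω) := by ring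
      rw [h3]
      refine (enorm_add_le _ _).trans ?_
      rw [enorm_mul, enorm_mul]
      gcongr
      · rw [← ofReal_norm]
        exact ENNReal.ofReal_le_ofReal h2
      · rw [← ofReal_norm]
        exact ENNReal.ofReal_le_ofReal h1
    · exact ((hgi.sub (integrable_mart g n)).1.enorm.restrict).const_mul _
  calc P A ^ (-1 - α) * ∫⁻ ω in A, ‖h ω * g ω - mart P 𝓕 (fun ω => h ω * g ω) n ω‖ₑ ∂P
      ≤ P A ^ (-1 - α) * (2 * (ENNReal.ofReal b * ∫⁻ ω in A, ‖g ω - mart P 𝓕 g n ω‖ₑ ∂P +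
        ENNReal.ofReal a * ∫⁻ ω in A, ‖h ω - mart P 𝓕 h n ω‖ₑ ∂P)) := by
        gcongr
        refine (setLIntegral_sub_condExp_le (hhi.mul_bdd hgi.1 hg) hint hA).trans ?_
        gcongr
    _ = 2 * (ENNReal.ofReal b * (P A ^ (-1 - α) * ∫⁻ ω in A, ‖g ω - mart P 𝓕 g n ω‖ₑ ∂P) +
        ENNReal.ofReal a * (P A ^ (-1 - α) * ∫⁻ ω in A, ‖h ω - mart P 𝓕 h n ω‖ₑ ∂P)) := by ring
    _ ≤ _ := by
        gcongr
        · exact hle g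
        · exact hle h

lemma Lip.exists_mul {g h : Lip 𝕜 P 𝓕 α} {a b : ℝ} (hg : ∀ᵐ ω ∂P, ‖g.toL2 ω‖ ≤ a)
    (hh : ∀ᵐ ω ∂P, ‖h.toL2 ω‖ ≤ b) :
    ∃ hg : Lip 𝕜 P 𝓕 α, ∀ᵐ ω ∂P, hg.toL2 ω = h.toL2 ω * g.toL2 ω := by
  have hmem : MemLp (fun ω => h.toL2 ω * g.toL2 ω) 2 P :=
    (Lp.memLp g.toL2).mul (memLp_top_of_bound (Lp.memLp h.toL2).1 b hh)
  have hfin : lipENorm P 𝓕 α (hmem.toLp : Lp 𝕜 2 P) < ∞ := by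
    rw [lipENorm_congr α hmem.coeFn_toLp]
    refine (lipENorm_mul_le (integrable_L2 _) (integrable_L2 _) hg hh).trans_lt ?_
    have := g.lipENorm_ne_top
    have := h.lipENorm_ne_top
    finiteness
  exact ⟨(⟨hmem.toLp, hfin⟩ : lipSubmodule 𝕜 P 𝓕 α), hmem.coeFn_toLp⟩

end Product

/-! ### The decomposition on the completion -/

/-- The three parts, extended to the completion. The second one takes its values in `H¹`, since the
`L¹` norm of the variation is lower semicontinuous on `L¹`. -/
lemma exists_extended_decomposition {Ω : Type*} {m0 : MeasurableSpace Ω} {𝕜 : Type*} [RCLike 𝕜]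
    (P : Measure Ω) [IsProbabilityMeasure P] (𝓕 : Filtration ℕ m0)
    (hgen : ⨆ k, 𝓕 k = m0) (hreg : IsRegular P 𝓕) (hatom : ∀ k, CountablyAtomic (𝓕 k))
    {p α : ℝ} (hp0 : 0 < p) (hp1 : p < 1) (hα : α = 1 / p - 1) :
    ∃ (T T₁ T₂ : HardyL1 𝕜 P 𝓕 ⟨p, hp0, hp1.le⟩ →ₗ[𝕜] Lip 𝕜 P 𝓕 α →ₗ[𝕜] Lp 𝕜 1 P)
      (T₃ : HardyL1 𝕜 P 𝓕 ⟨p, hp0, hp1.le⟩ →ₗ[𝕜] Lip 𝕜 P 𝓕 α →ₗ[𝕜]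
        HardyL1 𝕜 P 𝓕 ⟨p, hp0, hp1.le⟩)
      (Q₁ : Hardy 𝕜 P 𝓕 p hp0 hp1 →ₗ[𝕜] Lip 𝕜 P 𝓕 α →ₗ[𝕜] Lp 𝕜 1 P)
      (Q₂ : Hardy 𝕜 P 𝓕 p hp0 hp1 →ₗ[𝕜] Lip 𝕜 P 𝓕 α →ₗ[𝕜] HardyOne 𝕜 P 𝓕)
      (Q₃ : Hardy 𝕜 P 𝓕 p hp0 hp1 →ₗ[𝕜] Lip 𝕜 P 𝓕 α →ₗ[𝕜] Hardy 𝕜 P 𝓕 p hp0 hp1),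
      (∀ g : Lip 𝕜 P 𝓕 α, ∃ a : ℝ, ∀ᵐ ω ∂P, ‖g.toL2 ω‖ ≤ a) ∧
      (∀ f (g : Lip 𝕜 P 𝓕 α), ∀ᵐ ω ∂P, T f g ω = f.toL1 ω * g.toL2 ω) ∧
      (∀ f g, T f g = T₁ f g + T₂ f g + (T₃ f g).toL1) ∧
      (∀ f g, ∫ ω, T f g ω ∂P = ∫ ω, T₁ f g ω ∂P) ∧
      (∀ (f : HardyL1 𝕜 P 𝓕 ⟨p, hp0, hp1.le⟩) g,
        Q₁ (f : Hardy 𝕜 P 𝓕 p hp0 hp1) g = T₁ f g ∧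
        (Q₂ (f : Hardy 𝕜 P 𝓕 p hp0 hp1) g).toL1 = T₂ f g ∧
        Q₃ (f : Hardy 𝕜 P 𝓕 p hp0 hp1) g = (T₃ f g : Hardy 𝕜 P 𝓕 p hp0 hp1)) ∧
      (Continuous fun x : Hardy 𝕜 P 𝓕 p hp0 hp1 × Lip 𝕜 P 𝓕 α => Q₁ x.1 x.2) ∧
      (Continuous fun x : Hardy 𝕜 P 𝓕 p hp0 hp1 × Lip 𝕜 P 𝓕 α => Q₂ x.1 x.2) ∧
      (Continuous fun x : Hardy 𝕜 P 𝓕 p hp0 hp1 × Lip 𝕜 P 𝓕 α => Q₃ x.1 x.2) ∧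
      ∀ g, Continuous fun x => (Q₂ x g).toL1 := by
  have hα0 : 0 < α := hα ▸ sub_pos.2 ((one_lt_div hp0).2 hp1)
  have hp' : 0 < 1 / p := one_div_pos.2 hp0
  obtain ⟨K, hK, T, T₁, T₂, T₃, hbdd, hT, hdec, hint, h₁, h₂, hv₂, h₃⟩ :=
    exists_decomposition (𝕜 := 𝕜) (p := ⟨p, hp0, hp1.le⟩) (α := α) hgen hreg hatom hα hα0
  have hX := completion_dist_eq
    (HardyL1.dist_eq (𝕜 := 𝕜) (P := P) (𝓕 := 𝓕) (p := ⟨p, hp0, hp1.le⟩))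
  have hE : ∀ u v : Lp 𝕜 1 P, dist u v = dist (u - v) 0 := fun u v => by
    rw [dist_zero_right, dist_eq_norm]
  have hc : Continuous fun g : Lip 𝕜 P 𝓕 α => K * ‖g‖ := continuous_const.mul continuous_norm
  have hc0 : K * ‖(0 : Lip 𝕜 P 𝓕 α)‖ = 0 := by rw [norm_zero, mul_zero]
  have hcp : Continuous fun g : Lip 𝕜 P 𝓕 α => (K * ‖g‖) ^ p :=
    hc.rpow_const fun _ => Or.inr hp0.le
  have hcp0 : (K * ‖(0 : Lip 𝕜 P 𝓕 α)‖) ^ p = 0 := by rw [hc0, Real.zero_rpow hp0.ne']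
  obtain ⟨Q₁, hQ₁, hQ₁c, hQ₁b⟩ := exists_bilinear_extension hp' T₁
    (fun f g => (dist_zero_right (T₁ f g)).trans_le (h₁ f g))
  obtain ⟨Q₂, hQ₂, hQ₂c, hQ₂b⟩ := exists_bilinear_extension hp' T₂
    (fun f g => (dist_zero_right (T₂ f g)).trans_le (h₂ f g))
  obtain ⟨Q₃, hQ₃, hQ₃c, hQ₃b⟩ := exists_bilinear_extension_self T₃ h₃
  have hmoment : ∀ x g, squareMoment P 𝓕 1 (Q₂ x g) ≤
      ENNReal.ofReal (K * ‖g‖ * dist x 0 ^ (1 / p)) := by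
    intro x g
    refine (squareMoment_one_le _).trans ?_
    refine UniformSpace.Completion.induction_on x ?_ fun f => ?_
    · have hcl := (lowerSemicontinuous_lintegral_tsum_mdiff (𝕜 := 𝕜) (P := P)
        (𝓕 := 𝓕)).isClosed_epigraph
      refine hcl.preimage ((hQ₂c g).prodMk (ENNReal.continuous_ofReal.comp ?_))
      exact continuous_const.mul
        ((continuous_id.dist continuous_const).rpow_const fun _ => Or.inr hp'.le)
    · rw [hQ₂, ← UniformSpace.Completion.coe_zero, UniformSpace.Completion.dist_eq]
      exact hv₂ f g
  refine ⟨T, T₁, T₂, T₃, Q₁, codRestrictHardy Q₂ fun x g => (hmoment x g).trans_lt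
    ENNReal.ofReal_lt_top, Q₃, fun g => ⟨_, hbdd g⟩, hT, hdec, hint,
    fun f g => ⟨hQ₁ f g, hQ₂ f g, hQ₃ f g⟩, continuous_of_bilinear_bound hX hE hc hc0 hp' Q₁ hQ₁b,
    ?_, continuous_of_bilinear_bound hX hX hcp hcp0 one_pos Q₃ hQ₃b, hQ₂c⟩
  refine continuous_of_bilinear_bound hX HardyL1.dist_eq hc hc0 hp' _ fun x g => ?_
  rw [HardyL1.dist_zero]
  refine ENNReal.toReal_le_of_le_ofReal ?_ (hmoment x g)
  positivity

end

end MartHardy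

open MartHardy in
/-- The product `f × g` is the functional `h ↦ ⟨h g, f⟩` on `L^∞ ∩ Λ_1(α_p)`; the last clause says
that it is the sum of the functionals given by the three terms. -/
theorem theoremC {Ω : Type*} {m0 : MeasurableSpace Ω} {𝕜 : Type*} [RCLike 𝕜]
    (P : Measure Ω) [IsProbabilityMeasure P] (𝓕 : Filtration ℕ m0)
    (hgen : ⨆ k, 𝓕 k = m0) (hreg : IsRegular P 𝓕) (hatom : ∀ k, CountablyAtomic (𝓕 k))
    (p : ℝ) (hp0 : 0 < p) (hp1 : p < 1) :
    ∃ B : Hardy 𝕜 P 𝓕 p hp0 hp1 →ₗ[𝕜] Lip 𝕜 P 𝓕 (1 / p - 1) →ₗ[𝕜] 𝕜,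
      IsDualityPairing B ∧
      ∃ (Pi1 : Hardy 𝕜 P 𝓕 p hp0 hp1 →ₗ[𝕜] Lip 𝕜 P 𝓕 (1 / p - 1) →ₗ[𝕜] Lp 𝕜 1 P)
        (Pi2 : Hardy 𝕜 P 𝓕 p hp0 hp1 →ₗ[𝕜] Lip 𝕜 P 𝓕 (1 / p - 1) →ₗ[𝕜] HardyOne 𝕜 P 𝓕)
        (Pi3 : Hardy 𝕜 P 𝓕 p hp0 hp1 →ₗ[𝕜] Lip 𝕜 P 𝓕 (1 / p - 1) →ₗ[𝕜] Hardy 𝕜 P 𝓕 p hp0 hp1),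
        (Continuous fun x : Hardy 𝕜 P 𝓕 p hp0 hp1 × Lip 𝕜 P 𝓕 (1 / p - 1) => Pi1 x.1 x.2) ∧
        (Continuous fun x : Hardy 𝕜 P 𝓕 p hp0 hp1 × Lip 𝕜 P 𝓕 (1 / p - 1) => Pi2 x.1 x.2) ∧
        (Continuous fun x : Hardy 𝕜 P 𝓕 p hp0 hp1 × Lip 𝕜 P 𝓕 (1 / p - 1) => Pi3 x.1 x.2) ∧
        ∀ (f : Hardy 𝕜 P 𝓕 p hp0 hp1) (g h : Lip 𝕜 P 𝓕 (1 / p - 1)), MemLp h.toL2 ∞ P →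
          ∃ hg : Lip 𝕜 P 𝓕 (1 / p - 1), (∀ᵐ ω ∂P, hg.toL2 ω = h.toL2 ω * g.toL2 ω) ∧
            B f hg = (∫ ω, Pi1 f g ω * h.toL2 ω ∂P) + (∫ ω, (Pi2 f g).toL1 ω * h.toL2 ω ∂P) +
              B (Pi3 f g) h := by
  obtain ⟨T, T₁, T₂, T₃, Q₁, Q₂, Q₃, hbdd, hT, hdec, hint, hQ, hcont₁, hcont₂, hcont₃, hcont₂'⟩ :=
    exists_extended_decomposition (𝕜 := 𝕜) P 𝓕 hgen hreg hatom hp0 hp1 rfl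
  -- the pairing is the integral of the first part, as the other two parts have mean zero
  have hone : MemLp (fun _ : Ω => (1 : 𝕜)) ∞ P := memLp_const 1
  obtain ⟨B, hBdef⟩ : ∃ B : Hardy 𝕜 P 𝓕 p hp0 hp1 →ₗ[𝕜] Lip 𝕜 P 𝓕 (1 / p - 1) →ₗ[𝕜] 𝕜,
      ∀ x g, B x g = boundedPairing hone (Q₁ x g) :=
    ⟨Q₁.compr₂ (boundedPairing hone).toLinearMap, fun _ _ => rfl⟩
  have hBcont : Continuous fun x : Hardy 𝕜 P 𝓕 p hp0 hp1 × Lip 𝕜 P 𝓕 (1 / p - 1) =>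
      B x.1 x.2 := by
    simp only [hBdef]
    exact (boundedPairing hone).continuous.comp hcont₁
  have hB : ∀ (f : HardyL1 𝕜 P 𝓕 ⟨p, hp0, hp1.le⟩) (g : Lip 𝕜 P 𝓕 (1 / p - 1)),
      B (f : Hardy 𝕜 P 𝓕 p hp0 hp1) g = ∫ ω, f.toL1 ω * g.toL2 ω ∂P := by
    intro f g
    rw [hBdef, (hQ f g).1, boundedPairing_apply, ← integral_congr_ae (hT f g), hint]
    simp only [mul_one]
  refine ⟨B, ⟨hBcont, fun f g => ⟨?_, hB f g⟩⟩, Q₁, Q₂, Q₃, hcont₁, hcont₂, hcont₃,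
    fun x g h hh => ?_⟩
  · exact (L1.integrable_coeFn (T f g)).congr (hT f g)
  obtain ⟨hg, hhg⟩ := Lip.exists_mul (hbdd g).choose_spec (hbdd h).choose_spec
  refine ⟨hg, hhg, ?_⟩
  rw [← boundedPairing_apply hh, ← boundedPairing_apply hh]
  refine UniformSpace.Completion.induction_on x (isClosed_eq ?_ ?_) fun f => ?_
  · exact hBcont.comp (continuous_id.prodMk continuous_const)
  · refine (((boundedPairing hh).continuous.comp ?_).add
      ((boundedPairing hh).continuous.comp (hcont₂' g))).add (hBcont.comp (.prodMk ?_ ?_))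
    · exact hcont₁.comp (continuous_id.prodMk continuous_const)
    · exact hcont₃.comp (continuous_id.prodMk continuous_const)
    · exact continuous_const
  · rw [(hQ f g).1, (hQ f g).2.1, (hQ f g).2.2, hB, hB, ← boundedPairing_apply hh, ← map_add,
      ← map_add, ← hdec, boundedPairing_apply]
    refine integral_congr_ae ?_
    filter_upwards [hT f g, hhg] with ω h1 h2
    rw [h1, h2]
    ring
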